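/- **Setting.** Let $m,r\in\mathbb N\cup\{\infty\}$ with $1\le r$ and $r+1\le m$. Let $R_1,R_2,R_3$ be a frame of class $C^m$ (pointwise linearly independent vector fields, written as column vectors in the fixed affine coordinates $u$) on an open set $\Omega\subset\mathbb R^3$. Let $L^1,L^2,L^3$ be the dual coframe, and put $\Gamma_{ij}^k=L^k(DR_j)R_i$ and $c_{ij}^k=\Gamma_{ij}^k-\Gamma_{ji}^k$. Suppose that the frame is *rich*: $c_{ij}^k=0$ on $\Omega$ for all pairwise distinct $i,j,k$. Let $\rho=(w^1,w^2,w^3)$ be *Riemann coordinates* of class $C^{m+1}$ on a connected, nonempty open set $N\subset\Omega$, i.e. a coordinate system on $N$ with $r_j(w^i)=0$ for $i\ne j$ and $r_i(w^i)\neq 0$ everywhere on $N$. Let $Z_{ij}^k$, defined on $W=\rho(N)$, be $\Gamma_{ij}^k\circ\rho^{-1}$ computed for the normalized frame $r_i/r_i(w^i)=\partial/\partial w^i$. In Riemann coordinates the $\beta$-system, for $\gamma^i=\beta^i\circ\rho^{-1}$, reads $$\partial_i\gamma^j=Z_{ji}^j\gamma^j-Z_{jj}^i\gamma^i\quad(i\ne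 j),\qquad Z_{ik}^j\gamma^j=Z_{jk}^i\gamma^i\quad(i<j,\ k\neq i,\ k\ne j).$$ Solutions are understood to be of class $C^r$. Assume that the coefficient matrix of the algebraic part (the second group of equations) has rank $1$ at every point of $W$. **Theorem.** There is an index $i_0$ such that, for pairwise distinct $i,j,k$, $Z_{ij}^k$ vanishes identically on $W$ if $k\ne i_0$ and vanishes nowhere on $W$ if $k=i_0$. Moreover: (a) Every solution $\gamma$ on an open set $V\subset W$ has $\gamma^{i_0}\equiv0$, so that it is degenerate. For every $C^3$ function $\eta$ on an open set $U\subset N$ such that $R_i^T(D^2\eta)R_j=0$ on $U$ for all $i\neq j$, one has $R_{i_0}^T(D^2\eta)R_{i_0}\equiv0$ on $U$, so the extension $\eta$ is degenerate. (b) Say that a function is *regular at* $p$ if, near $p$, it either vanishes identically or is nonzero on a dense set. Let $\{i_0,j,k\}=\{1,2,3\}$. Call $p\in W$ a *regular point* if $Z_{i_0i_0}^j$ and $Z_{i_0i_0}^k$ are regular at $p$ and, in case $Z_{i_0i_0}^j$ vanishes identically near $p$ and $Z_{i_0i_0}^k$ does not, $Z_{kk}^j$ is regular at $p$ as well (and likewise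 with $j$ and $k$ exchanged). The regular points form an open dense subset of $W$, and for every regular point $p$ exactly one of the following holds: 1. locally at $p$, the system has only the trivial solution $\gamma^1=\gamma^2=\gamma^3\equiv0$; 2. locally at $p$, two of the $\gamma^i$, among them $\gamma^{i_0}$, vanish identically for all solutions, and the third depends on one arbitrary function of one variable; 3. locally at $p$, $\gamma^{i_0}$ vanishes identically for all solutions, and the other two depend on two arbitrary functions of one variable. Here "locally at $p$, $\gamma^i\equiv0$ for $i\notin S$, and the $\gamma^i$, $i\in S$, depend on $|S|$ arbitrary functions of one variable" means: there is $\delta_0>0$ such that the open cube of half-width $\delta_0$ centred at $p$ lies in $W$ and, for each $0<\delta\le\delta_0$, on the open cube $Q$ of half-width $\delta$ centred at $p$, all solutions on $Q$ have $\gamma^i\equiv 0$ for $i\notin S$, and for all $C^r$ functions $\varphi_i$ on $(p^i-\delta,p^i+\delta)$, $i\in S$, there is exactly one solution $\gamma$ on $Q$ whose component $\gamma^i$ equals $\varphi_i(w^i)$ on the $w^i$-coordinate line through $p$, for each $i\in S$. The cases (1), (2), (3) correspond to $S=\emptyset$, to $S=\{k\}$ with some $k\neq i_0$, and to $S=\{1,2,3\}\setminus\{i_0\}$.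 -/

import Mathlib

open Filter Topology

noncomputable section

namespace RichFrame

variable {n : ℕ}

/-- `R 0, …, R (n-1)` is a frame of class `C^m` on `Ω ⊆ ℝⁿ`; `R i u` is the column vector of the
components of the `i`-th field at `u` in the fixed affine coordinates `u`. -/
structure IsFrame (m : ℕ∞) (R : Fin n → (Fin n → ℝ) → (Fin n → ℝ)) (Ω : Set (Fin n → ℝ)) :
    Prop where
  contDiffOn : ∀ i, ContDiffOn ℝ m (R i) Ω
  linearIndependent : ∀ u ∈ Ω, LinearIndependent ℝ (fun i => R i u)

/-- The matrix whose columns are the frame vectors. -/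
def frameMatrix (R : Fin n → (Fin n → ℝ) → (Fin n → ℝ)) (u : Fin n → ℝ) :
    Matrix (Fin n) (Fin n) ℝ :=
  Matrix.of fun a i => R i u a

/-- The matrix whose rows are the vectors of the dual coframe. -/
def coframeMatrix (R : Fin n → (Fin n → ℝ) → (Fin n → ℝ)) (u : Fin n → ℝ) :
    Matrix (Fin n) (Fin n) ℝ :=
  (frameMatrix R u)⁻¹

/-- The connection coefficients `Γ_{ij}^k = L^k (D R_j) R_i` of the flat connection of `ℝⁿ`
relative to the frame. The order of the arguments is `i`, `j`, `k`. -/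
def christoffel (R : Fin n → (Fin n → ℝ) → (Fin n → ℝ)) (i j k : Fin n) (u : Fin n → ℝ) : ℝ :=
  (coframeMatrix R u).mulVec (fderiv ℝ (R j) u (R i u)) k

/-- The structure coefficients `c_{ij}^k = Γ_{ij}^k - Γ_{ji}^k`. -/
def structureCoeff (R : Fin n → (Fin n → ℝ) → (Fin n → ℝ)) (i j k : Fin n) (u : Fin n → ℝ) : ℝ :=
  christoffel R i j k u - christoffel R j i k u

/-- A frame is rich if `c_{ij}^k = 0` for all pairwise distinct `i, j, k`. -/
def IsRich (R : Fin n → (Fin n → ℝ) → (Fin n → ℝ)) (Ω : Set (Fin n → ℝ)) : Prop :=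
  ∀ i j k, i ≠ j → j ≠ k → i ≠ k → ∀ u ∈ Ω, structureCoeff R i j k u = 0

/-- The derivative `r_j (w^i)` of the `i`-th component of `w` along the `j`-th frame field. -/
def alongFrame (R : Fin n → (Fin n → ℝ) → (Fin n → ℝ)) (w : (Fin n → ℝ) → (Fin n → ℝ))
    (j i : Fin n) (u : Fin n → ℝ) : ℝ :=
  fderiv ℝ w u (R j u) i

/-- `ρ = (w^1, …, w^n)`, defined on `ρ.source`, is a system of Riemann coordinates of class `C^m`
for the frame: `r_j (w^i) = 0` for `i ≠ j`, and `r_i (w^i)` vanishes nowhere. -/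
structure IsRiemannCoordinates (m : ℕ∞) (R : Fin n → (Fin n → ℝ) → (Fin n → ℝ))
    (ρ : OpenPartialHomeomorph (Fin n → ℝ) (Fin n → ℝ)) : Prop where
  contDiffOn : ContDiffOn ℝ m ρ ρ.source
  off_diag : ∀ i j, i ≠ j → ∀ u ∈ ρ.source, alongFrame R ρ j i u = 0
  diag : ∀ i, ∀ u ∈ ρ.source, alongFrame R ρ i i u ≠ 0

/-- The normalized frame `r_i / r_i (w^i)`, that is `∂ / ∂ w^i`. -/
def normalizedFrame (R : Fin n → (Fin n → ℝ) → (Fin n → ℝ))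
    (ρ : OpenPartialHomeomorph (Fin n → ℝ) (Fin n → ℝ)) (i : Fin n) (u : Fin n → ℝ) :
    Fin n → ℝ :=
  (alongFrame R ρ i i u)⁻¹ • R i u

/-- The coefficients `Z_{ij}^k = Γ_{ij}^k ∘ ρ⁻¹` of the normalized frame in Riemann
coordinates. The order of the arguments is `i`, `j`, `k`. -/
def riemannCoeff (R : Fin n → (Fin n → ℝ) → (Fin n → ℝ))
    (ρ : OpenPartialHomeomorph (Fin n → ℝ) (Fin n → ℝ)) (i j k : Fin n) (w : Fin n → ℝ) : ℝ :=
  christoffel (normalizedFrame R ρ) i j k (ρ.symm w)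

/-- `γ = (γ^1, …, γ^n)` is a solution of class `C^r`, on the open set `V` of the space of Riemann
coordinates, of the β-system with coefficients `Z`:
`∂_i γ^j = Z_{ji}^j γ^j - Z_{jj}^i γ^i` for `i ≠ j` (differential part) and
`Z_{ik}^j γ^j = Z_{jk}^i γ^i` for `i < j`, `k ≠ i`, `k ≠ j` (algebraic part). -/
structure IsBetaSolution (Z : Fin n → Fin n → Fin n → (Fin n → ℝ) → ℝ) (r : ℕ∞)
    (V : Set (Fin n → ℝ)) (γ : Fin n → (Fin n → ℝ) → ℝ) : Prop where
  contDiffOn : ∀ i, ContDiffOn ℝ r (γ i) V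
  differential : ∀ i j, i ≠ j → ∀ w ∈ V,
    fderiv ℝ (γ j) w (Pi.single i 1) = Z j i j w * γ j w - Z j j i w * γ i w
  algebraic : ∀ i j k, i < j → k ≠ i → k ≠ j → ∀ w ∈ V,
    Z i k j w * γ j w = Z j k i w * γ i w

/-- The coefficient matrix of the algebraic part of the β-system for `n = 3`; its rows are the
equations for `(i, j, k) = (2, 3, 1), (1, 3, 2), (1, 2, 3)`, with indices counted from one. -/
def algebraicMatrix (Z : Fin 3 → Fin 3 → Fin 3 → (Fin 3 → ℝ) → ℝ) (w : Fin 3 → ℝ) :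
    Matrix (Fin 3) (Fin 3) ℝ :=
  !![0, -Z 2 0 1 w, Z 1 0 2 w;
     -Z 2 1 0 w, 0, Z 0 1 2 w;
     -Z 1 2 0 w, Z 0 2 1 w, 0]

theorem algebraicMatrix_mulVec_eq_zero_iff (Z : Fin 3 → Fin 3 → Fin 3 → (Fin 3 → ℝ) → ℝ)
    (w : Fin 3 → ℝ) (g : Fin 3 → ℝ) :
    (algebraicMatrix Z w).mulVec g = 0 ↔
      ∀ i j k : Fin 3, i < j → k ≠ i → k ≠ j → Z i k j w * g j = Z j k i w * g i := by
  constructor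
  · intro h i j k hij hki hkj
    have h0 := congrFun h 0
    have h1 := congrFun h 1
    have h2 := congrFun h 2
    simp [algebraicMatrix, Matrix.mulVec, dotProduct, Fin.sum_univ_three] at h0 h1 h2
    fin_cases i <;> fin_cases j <;> fin_cases k <;> simp at hij hki hkj ⊢ <;> linarith
  · intro h
    have h0 := h 1 2 0 (by decide) (by decide) (by decide)
    have h1 := h 0 2 1 (by decide) (by decide) (by decide)
    have h2 := h 0 1 2 (by decide) (by decide) (by decide)
    funext a
    fin_cases a <;>
      simp [algebraicMatrix, Matrix.mulVec, dotProduct, Fin.sum_univ_three] <;> linarith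

/-- `η` makes the frame orthogonal on `U` with respect to the inner product given by its Hessian:
`R_iᵀ (D² η) R_j = 0` for `i ≠ j`. -/
def IsOrthogonalForHessian (R : Fin n → (Fin n → ℝ) → (Fin n → ℝ)) (η : (Fin n → ℝ) → ℝ)
    (U : Set (Fin n → ℝ)) : Prop :=
  ∀ i j, i ≠ j → ∀ u ∈ U, fderiv ℝ (fderiv ℝ η) u (R i u) (R j u) = 0

/-- Near `p` the function `f` either vanishes identically or is nonzero on a dense set. -/
def IsRegularAt (f : (Fin n → ℝ) → ℝ) (p : Fin n → ℝ) : Prop :=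
  (∀ᶠ w in 𝓝 p, f w = 0) ∨ (∀ᶠ w in 𝓝 p, w ∈ closure {w' | f w' ≠ 0})

/-- Points at which each coefficient that decides the shape of the solution set either vanishes
identically nearby or is nonzero on a dense set nearby. With `i₀ = 1` these coefficients are
`Z_{11}^2` and `Z_{11}^3` and, only if exactly one of these two vanishes identically nearby,
`Z_{33}^2` (when it is `Z_{11}^2`) or `Z_{22}^3` (when it is `Z_{11}^3`). -/
def IsRegularPoint (Z : Fin n → Fin n → Fin n → (Fin n → ℝ) → ℝ) (i₀ : Fin n)
    (p : Fin n → ℝ) : Prop :=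
  ∀ j k, j ≠ i₀ → k ≠ i₀ → j ≠ k →
    IsRegularAt (Z i₀ i₀ j) p ∧
      ((∀ᶠ w in 𝓝 p, Z i₀ i₀ j w = 0) → ¬ (∀ᶠ w in 𝓝 p, Z i₀ i₀ k w = 0) →
        IsRegularAt (Z k k j) p)

/-- Near `p`, the `C^r` solutions of the β-system have `γ^i ≡ 0` for all `i ∉ S`, while the
components `γ^i`, `i ∈ S`, depend on `#S` arbitrary functions of one variable: the values of `γ^i`
along the `w^i`-coordinate line through `p` can be prescribed arbitrarily for `i ∈ S`, and they
determine the solution. Balls are cubes, since `Fin n → ℝ` carries the maximum norm. -/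
def SolutionsFreeIn (Z : Fin n → Fin n → Fin n → (Fin n → ℝ) → ℝ) (r : ℕ∞)
    (W : Set (Fin n → ℝ)) (S : Finset (Fin n)) (p : Fin n → ℝ) : Prop :=
  ∃ δ₀ > 0, Metric.ball p δ₀ ⊆ W ∧ ∀ δ, 0 < δ → δ ≤ δ₀ →
    (∀ γ, IsBetaSolution Z r (Metric.ball p δ) γ →
      ∀ i ∉ S, ∀ w ∈ Metric.ball p δ, γ i w = 0) ∧
    (∀ φ : Fin n → ℝ → ℝ, (∀ i ∈ S, ContDiffOn ℝ r (φ i) (Metric.ball (p i) δ)) →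
      ∃ γ, IsBetaSolution Z r (Metric.ball p δ) γ ∧
        ∀ i ∈ S, ∀ t ∈ Metric.ball (p i) δ, γ i (Function.update p i t) = φ i t) ∧
    (∀ γ γ', IsBetaSolution Z r (Metric.ball p δ) γ → IsBetaSolution Z r (Metric.ball p δ) γ' →
      (∀ i ∈ S, ∀ t ∈ Metric.ball (p i) δ,
        γ i (Function.update p i t) = γ' i (Function.update p i t)) →
      ∀ i, ∀ w ∈ Metric.ball p δ, γ i w = γ' i w)

/-- Case (1): only the trivial solution. -/
def OnlyTrivial (Z : Fin 3 → Fin 3 → Fin 3 → (Fin 3 → ℝ) → ℝ) (r : ℕ∞)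
    (W : Set (Fin 3 → ℝ)) (p : Fin 3 → ℝ) : Prop :=
  SolutionsFreeIn Z r W ∅ p

/-- Case (2): two components vanish identically, among them the one with index `i₀`, and the third
one depends on one arbitrary function of one variable. -/
def OneFreeFunction (Z : Fin 3 → Fin 3 → Fin 3 → (Fin 3 → ℝ) → ℝ) (r : ℕ∞)
    (W : Set (Fin 3 → ℝ)) (i₀ : Fin 3) (p : Fin 3 → ℝ) : Prop :=
  ∃ k, k ≠ i₀ ∧ SolutionsFreeIn Z r W {k} p

/-- Case (3): the component with index `i₀` vanishes identically, and the other two depend on two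
arbitrary functions of one variable. -/
def TwoFreeFunctions (Z : Fin 3 → Fin 3 → Fin 3 → (Fin 3 → ℝ) → ℝ) (r : ℕ∞)
    (W : Set (Fin 3 → ℝ)) (i₀ : Fin 3) (p : Fin 3 → ℝ) : Prop :=
  SolutionsFreeIn Z r W (Finset.univ.erase i₀) p

end RichFrame

end

/-!
Write `F = ρ⁻¹` for the inverse of the Riemann coordinates. The normalized frame is `∂_j F`, and
the `Z_{ij}^k` are the components of `∂_i ∂_j F` in this basis, `Z_{ij}^k = dw^k (∂_i ∂_j F)`.
Hence they are of class `C^r`, symmetric in `i`, `j`, and the symmetry of `∂_l ∂_i (∂_j F)` gives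
the equations of a flat connection (`IsRiemannCoordinates.flatness`).

By the symmetry, the algebraic matrix contains only three coefficients up to sign, `Z_{ij}^k` with
`{i, j, k} = {1, 2, 3}`, and its `2 × 2` minors contain the products of any two of them. Rank one
therefore means that exactly one of them is nonzero, and which one does not change on the
connected set `W`; this is `i₀`. The algebraic equations then reduce to `γ^{i₀} = 0`. For an
extension `η`, the derivatives of `(D²η)(∂_i, ∂_j) = 0` along `∂_k`, for two arrangements of the
three indices, have the same third order term; the difference is
`Z_{jk}^{i₀} (D²η)(∂_{i₀}, ∂_{i₀}) = 0`.

Let `{i₀, j, k} = {1, 2, 3}`. With `γ^{i₀} = 0` the equations for `∂_j γ^{i₀}` and `∂_k γ^{i₀}`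
become `Z_{i₀i₀}^j γ^j = 0` and `Z_{i₀i₀}^k γ^k = 0`, and if also `γ^k = 0`, then
`Z_{kk}^j γ^j = 0`. At a regular point each of these conditions is either void or forces a component
to vanish, by continuity. The other equations form the linear system `∂_{i₀} u = A u`, `∂_{i₀} v = B v`,
`∂_k u = C u - D v`, `∂_j v = E v - G u` for `u = γ^j`, `v = γ^k`, and flatness provides its
compatibility conditions as far as the coefficients `Z_{i₀i₀}^j`, `Z_{i₀i₀}^k` that enter them
vanish. If only `γ^j` remains, its equations are the case `B = D = E = G = 0`, `v = 0`.
Integrating factors (`exists_integratingFactor`) remove `A`, `B`, `C`, `E`, after which the system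
does not depend on `w^{i₀}` and is a Goursat problem `∂_k U = D V`, `∂_j V = G U` in the plane.
Successive approximation solves it on small cubes (`exists_eq_add_goursatOp`), where its Volterra
operator is a contraction with a constant that does not depend on the possibly unbounded data. The
result is `darboux_wellPosed`.

Regularity is measured by partial derivatives along coordinate lines (`HasPartialAt`), since
integrals along such lines are easy to differentiate in this sense, and continuous partial
derivatives give `C^n` regularity (`contDiffOn_succ_of_hasPartialAt`).

That the three cases exclude each other is seen from the solution with data `1`: it shows that the
set of the free components is determined by the solutions (`SolutionsFreeIn.eq`).
-/

noncomputable section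

namespace RichFrame

/-! ### Cubes and coordinate lines -/

section Cube

variable {n : ℕ} {p w : Fin n → ℝ} {δ t : ℝ} {i : Fin n}

theorem apply_mem_ball (hw : w ∈ Metric.ball p δ) (i : Fin n) : w i ∈ Metric.ball (p i) δ :=
  (dist_le_pi_dist w p i).trans_lt hw

theorem apply_mem_closedBall (hw : w ∈ Metric.closedBall p δ) (i : Fin n) :
    w i ∈ Metric.closedBall (p i) δ :=
  (dist_le_pi_dist w p i).trans hw

theorem update_mem_ball (hw : w ∈ Metric.ball p δ) (ht : t ∈ Metric.ball (p i) δ) :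
    Function.update w i t ∈ Metric.ball p δ := by
  have hδ : 0 < δ := Metric.pos_of_mem_ball hw
  rw [Metric.mem_ball, dist_pi_lt_iff hδ]
  intro j
  rcases eq_or_ne j i with rfl | hj
  · simpa using ht
  · simpa [hj] using apply_mem_ball hw j

theorem update_mem_closedBall (hw : w ∈ Metric.closedBall p δ)
    (ht : t ∈ Metric.closedBall (p i) δ) :
    Function.update w i t ∈ Metric.closedBall p δ := by
  have hδ : 0 ≤ δ := dist_nonneg.trans hw
  rw [Metric.mem_closedBall, dist_pi_le_iff hδ]
  intro j
  rcases eq_or_ne j i with rfl | hj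
  · simpa using ht
  · simpa [hj] using apply_mem_closedBall hw j

theorem uIcc_subset_ball {a b : ℝ} (hb : b ∈ Metric.ball a δ) :
    Set.uIcc a b ⊆ Metric.ball a δ :=
  (convex_ball a δ).ordConnected.uIcc_subset
    (Metric.mem_ball_self (Metric.pos_of_mem_ball hb)) hb

theorem uIcc_subset_closedBall {a b : ℝ} (hb : b ∈ Metric.closedBall a δ) :
    Set.uIcc a b ⊆ Metric.closedBall a δ :=
  (convex_closedBall a δ).ordConnected.uIcc_subset
    (Metric.mem_closedBall_self (dist_nonneg.trans hb)) hb

theorem update_center_mem_ball (hw : w ∈ Metric.ball p δ) (i : Fin n) :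
    Function.update w i (p i) ∈ Metric.ball p δ :=
  update_mem_ball hw (Metric.mem_ball_self (Metric.pos_of_mem_ball hw))

theorem line_mem_ball (ht : t ∈ Metric.ball (p i) δ) :
    Function.update p i t ∈ Metric.ball p δ :=
  update_mem_ball (Metric.mem_ball_self (Metric.pos_of_mem_ball ht)) ht

theorem exists_lt_mem_ball (hw : w ∈ Metric.ball p δ) :
    ∃ ε, 0 < ε ∧ ε < δ ∧ w ∈ Metric.ball p ε := by
  obtain ⟨ε, h1, h2⟩ := exists_between (show dist w p < δ from hw)
  exact ⟨ε, dist_nonneg.trans_lt h1, h2, h1⟩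

/-- By the Tietze extension theorem a function that is continuous on an open cube agrees, on any
smaller closed cube, with a globally continuous function. -/
theorem exists_continuous_eqOn_closedBall {f : (Fin n → ℝ) → ℝ} {ε : ℝ}
    (hf : ContinuousOn f (Metric.ball p δ)) (hε : ε < δ) :
    ∃ g : (Fin n → ℝ) → ℝ, Continuous g ∧ Set.EqOn f g (Metric.closedBall p ε) := by
  have h := hf.mono (Metric.closedBall_subset_ball hε)
  obtain ⟨g, hg⟩ := ContinuousMap.exists_restrict_eq (Metric.isClosed_closedBall (x := p) (ε := ε))
    (⟨_, continuousOn_iff_continuous_domRestrict.1 h⟩ : C(Metric.closedBall p ε, ℝ))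
  refine ⟨g, g.continuous, fun w hw => ?_⟩
  have := DFunLike.congr_fun hg ⟨w, hw⟩
  simpa using this.symm

theorem exists_bound_closedBall {f : (Fin n → ℝ) → ℝ} {ε : ℝ}
    (hf : ContinuousOn f (Metric.ball p δ)) (hε : ε < δ) :
    ∃ K, 0 ≤ K ∧ ∀ w ∈ Metric.closedBall p ε, |f w| ≤ K := by
  obtain ⟨K, hK⟩ := (isCompact_closedBall p ε).exists_bound_of_continuousOn
    (hf.mono (Metric.closedBall_subset_ball hε))
  exact ⟨max K 0, le_max_right _ _, fun w hw => (hK w hw).trans (le_max_left _ _)⟩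

theorem continuous_update_line (w : Fin n → ℝ) (i : Fin n) :
    Continuous fun t : ℝ => Function.update w i t :=
  continuous_const.update i continuous_id

end Cube

/-! ### Partial derivatives -/

/-- `f` has the partial derivative `f'` at `w` in the direction of the `i`-th coordinate. -/
def HasPartialAt {n : ℕ} (i : Fin n) (f : (Fin n → ℝ) → ℝ) (f' : ℝ) (w : Fin n → ℝ) : Prop :=
  HasDerivAt (fun t => f (Function.update w i t)) f' (w i)

section Partial

variable {n : ℕ} {i : Fin n} {f g : (Fin n → ℝ) → ℝ} {f' g' : ℝ} {w p : Fin n → ℝ} {δ : ℝ}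

theorem _root_.HasFDerivAt.hasPartialAt {L : (Fin n → ℝ) →L[ℝ] ℝ} (h : HasFDerivAt f L w)
    (i : Fin n) : HasPartialAt i f (L (Pi.single i 1)) w := by
  have h1 : HasFDerivAt f L (Function.update w i (w i)) := by simpa using h
  exact h1.comp_hasDerivAt (w i) (hasDerivAt_update w i (w i))

theorem _root_.DifferentiableAt.hasPartialAt (h : DifferentiableAt ℝ f w) (i : Fin n) :
    HasPartialAt i f (fderiv ℝ f w (Pi.single i 1)) w :=
  h.hasFDerivAt.hasPartialAt i

theorem HasPartialAt.fderiv_eq (h : HasPartialAt i f f' w) (hf : DifferentiableAt ℝ f w) :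
    fderiv ℝ f w (Pi.single i 1) = f' :=
  (hf.hasPartialAt i).unique h

theorem HasPartialAt.hasDerivAt_update {t : ℝ}
    (h : HasPartialAt i f f' (Function.update w i t)) :
    HasDerivAt (fun s => f (Function.update w i s)) f' t := by
  simpa [HasPartialAt] using h

theorem HasPartialAt.congr_of_eventuallyEq (h : HasPartialAt i f f' w) (hfg : g =ᶠ[𝓝 w] f) :
    HasPartialAt i g f' w := by
  refine HasDerivAt.congr_of_eventuallyEq h ?_
  have : Tendsto (fun t => Function.update w i t) (𝓝 (w i)) (𝓝 w) := by
    have := (continuous_update_line w i).tendsto (w i)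
    simpa using this
  exact this.eventually hfg

theorem HasPartialAt.add (hf : HasPartialAt i f f' w) (hg : HasPartialAt i g g' w) :
    HasPartialAt i (fun w => f w + g w) (f' + g') w :=
  HasDerivAt.add hf hg

theorem HasPartialAt.sub (hf : HasPartialAt i f f' w) (hg : HasPartialAt i g g' w) :
    HasPartialAt i (fun w => f w - g w) (f' - g') w :=
  HasDerivAt.sub hf hg

theorem hasPartialAt_const (i : Fin n) (c : ℝ) (w : Fin n → ℝ) :
    HasPartialAt i (fun _ => c) 0 w :=
  hasDerivAt_const _ _

theorem HasPartialAt.mul (hf : HasPartialAt i f f' w) (hg : HasPartialAt i g g' w) :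
    HasPartialAt i (fun w => f w * g w) (f' * g w + f w * g') w := by
  simpa [HasPartialAt] using HasDerivAt.fun_mul hf hg

theorem HasPartialAt.div (hf : HasPartialAt i f f' w) (hg : HasPartialAt i g g' w)
    (h0 : g w ≠ 0) :
    HasPartialAt i (fun w => f w / g w) ((f' * g w - f w * g') / g w ^ 2) w := by
  simpa [HasPartialAt] using HasDerivAt.fun_div hf hg (by simpa using h0)

theorem HasPartialAt.exp (hf : HasPartialAt i f f' w) :
    HasPartialAt i (fun w => Real.exp (f w)) (Real.exp (f w) * f') w := by
  have := HasDerivAt.exp hf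
  simpa [HasPartialAt] using this

theorem hasPartialAt_zero_of_invariant (hw : w ∈ Metric.ball p δ)
    (h : ∀ w ∈ Metric.ball p δ, ∀ t ∈ Metric.ball (p i) δ, f (Function.update w i t) = f w) :
    HasPartialAt i f 0 w := by
  refine (hasDerivAt_const (w i) (f w)).congr_of_eventuallyEq ?_
  filter_upwards [Metric.isOpen_ball.mem_nhds (apply_mem_ball hw i)] with t ht
  exact h w hw t ht

/-- If the `i`-th partial derivative vanishes on a cube, the function does not depend on the
`i`-th coordinate there. -/
theorem invariant_of_hasPartialAt_zero
    (h : ∀ w ∈ Metric.ball p δ, HasPartialAt i f 0 w) :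
    ∀ w ∈ Metric.ball p δ, ∀ t ∈ Metric.ball (p i) δ, f (Function.update w i t) = f w := by
  intro w hw t ht
  have key := (convex_ball (p i) δ).norm_image_sub_le_of_norm_hasDerivWithin_le (𝕜 := ℝ)
    (f := fun s => f (Function.update w i s)) (f' := fun _ => 0) (C := 0)
    (fun s hs => ((h _ (update_mem_ball hw hs)).hasDerivAt_update).hasDerivWithinAt)
    (by simp) (apply_mem_ball hw i) ht
  simpa [sub_eq_zero] using key

/-- A function whose partial derivatives exist near `w` and are continuous at `w` is differentiable
at `w`. One passes from `w` to a nearby point by changing one coordinate after the other and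
applies the mean value inequality to each step. -/
theorem hasFDerivAt_of_hasPartialAt {g : Fin n → (Fin n → ℝ) → ℝ}
    (h : ∀ᶠ v in 𝓝 w, ∀ i, HasPartialAt i f (g i v) v) (hg : ∀ i, ContinuousAt (g i) w) :
    HasFDerivAt f (∑ i, g i w • ContinuousLinearMap.proj (R := ℝ) (φ := fun _ => ℝ) i) w := by
  classical
  have key : ∀ s : Finset (Fin n), HasFDerivAt (fun v => f (s.piecewise v w))
      (∑ i ∈ s, g i w • ContinuousLinearMap.proj (R := ℝ) (φ := fun _ => ℝ) i) w := by
    intro s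
    induction s using Finset.induction_on with
    | empty => simpa using hasFDerivAt_const (f w) w
    | insert i s hi ih =>
      rw [Finset.sum_insert hi, add_comm]
      have hstep : HasFDerivAt
          (fun v => f ((insert i s).piecewise v w) - f (s.piecewise v w))
          (g i w • ContinuousLinearMap.proj (R := ℝ) (φ := fun _ => ℝ) i) w := by
        rw [hasFDerivAt_iff_isLittleO, Asymptotics.isLittleO_iff]
        intro c hc
        obtain ⟨ε, hε, hball⟩ := Metric.eventually_nhds_iff_ball.1
          (h.and ((hg i).eventually (Metric.ball_mem_nhds (g i w) hc)))
        filter_upwards [Metric.ball_mem_nhds w hε] with v hv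
        have hz : s.piecewise v w ∈ Metric.ball w ε := by
          rw [Metric.mem_ball, dist_pi_lt_iff hε]
          intro j
          by_cases hj : j ∈ s
          · simpa [hj] using apply_mem_ball hv j
          · simpa [hj] using hε
        have hzi : s.piecewise v w i = w i := by simp [hi]
        have hmv := (convex_ball (w i) ε).norm_image_sub_le_of_norm_hasDerivWithin_le (𝕜 := ℝ)
          (f := fun t => f (Function.update (s.piecewise v w) i t) - g i w * t)
          (f' := fun t => g i (Function.update (s.piecewise v w) i t) - g i w * 1) (C := c)
          (fun t ht => ((((hball _ (update_mem_ball hz ht)).1 i).hasDerivAt_update).sub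
            ((hasDerivAt_id t).const_mul (g i w))).hasDerivWithinAt)
          (fun t ht => by
            have := (hball _ (update_mem_ball hz ht)).2
            rw [dist_eq_norm] at this
            simpa using this.le)
          (Metric.mem_ball_self hε) (apply_mem_ball hv i)
        have hu1 : Function.update (s.piecewise v w) i (v i) = (insert i s).piecewise v w := by
          rw [Finset.piecewise_insert]
        have hu2 : Function.update (s.piecewise v w) i (w i) = s.piecewise v w := by
          rw [← hzi, Function.update_eq_self]
        rw [hu1, hu2] at hmv
        have hn : ‖v i - w i‖ ≤ ‖v - w‖ := norm_le_pi_norm (v - w) i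
        refine le_trans (le_of_eq ?_) (hmv.trans (mul_le_mul_of_nonneg_left hn hc.le))
        congr 1
        simp only [Finset.piecewise_same, sub_self, sub_zero, FunLike.coe_smul,
          Pi.smul_apply, ContinuousLinearMap.proj_apply, Pi.sub_apply, smul_eq_mul]
        ring
      exact (ih.add hstep).congr_of_eventuallyEq (Eventually.of_forall fun v => by simp)
  simpa using key Finset.univ

theorem contDiffOn_succ_of_hasPartialAt {U : Set (Fin n → ℝ)} (hU : IsOpen U) {N : ℕ}
    {g : Fin n → (Fin n → ℝ) → ℝ} (h : ∀ i, ∀ w ∈ U, HasPartialAt i f (g i w) w)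
    (hg : ∀ i, ContDiffOn ℝ N (g i) U) : ContDiffOn ℝ (N + 1 : ℕ) f U := by
  have hd : ∀ w ∈ U, HasFDerivAt f
      (∑ i, g i w • ContinuousLinearMap.proj (R := ℝ) (φ := fun _ => ℝ) i) w := fun w hw =>
    hasFDerivAt_of_hasPartialAt
      (by filter_upwards [hU.mem_nhds hw] with v hv using fun i => h i v hv)
      fun i => (hg i).continuousOn.continuousAt (hU.mem_nhds hw)
  push_cast
  rw [contDiffOn_succ_iff_fderiv_of_isOpen hU]
  refine ⟨fun w hw => (hd w hw).differentiableAt.differentiableWithinAt, by simp, ?_⟩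
  refine ContDiffOn.congr (f := fun w => ∑ i, g i w •
    ContinuousLinearMap.proj (R := ℝ) (φ := fun _ => ℝ) i) ?_ fun w hw => (hd w hw).fderiv
  exact ContDiffOn.sum fun i _ => (hg i).smul contDiffOn_const

end Partial

/-! ### Primitives along coordinate lines -/

/-- The primitive of `h` in the direction of the `k`-th coordinate which vanishes on the hyperplane
`w k = p k`. -/
def coordPrimitive {n : ℕ} (p : Fin n → ℝ) (k : Fin n) (h : (Fin n → ℝ) → ℝ) (w : Fin n → ℝ) : ℝ :=
  ∫ t in p k..w k, h (Function.update w k t)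

section Primitive

variable {n : ℕ} {p w : Fin n → ℝ} {δ ε : ℝ} {i k : Fin n} {g h : (Fin n → ℝ) → ℝ}

theorem coordPrimitive_congr (hw : w ∈ Metric.ball p δ) (hgh : Set.EqOn g h (Metric.ball p δ)) :
    coordPrimitive p k g w = coordPrimitive p k h w :=
  intervalIntegral.integral_congr fun _ ht =>
    hgh (update_mem_ball hw (uIcc_subset_ball (apply_mem_ball hw k) ht))

theorem coordPrimitive_congr_closedBall (hw : w ∈ Metric.closedBall p ε)
    (hgh : Set.EqOn g h (Metric.closedBall p ε)) :
    coordPrimitive p k g w = coordPrimitive p k h w :=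
  intervalIntegral.integral_congr fun _ ht =>
    hgh (update_mem_closedBall hw (uIcc_subset_closedBall (apply_mem_closedBall hw k) ht))

theorem continuousOn_line (hh : ContinuousOn h (Metric.ball p δ)) (hw : w ∈ Metric.ball p δ)
    (k : Fin n) :
    ContinuousOn (fun t => h (Function.update w k t)) (Metric.ball (p k) δ) :=
  hh.comp (continuous_update_line w k).continuousOn fun _ ht => update_mem_ball hw ht

theorem intervalIntegrable_line (hh : ContinuousOn h (Metric.ball p δ))
    (hw : w ∈ Metric.ball p δ) (k : Fin n) :
    IntervalIntegrable (fun t => h (Function.update w k t)) MeasureTheory.volume (p k) (w k) :=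
  ((continuousOn_line hh hw k).mono
    (uIcc_subset_ball (apply_mem_ball hw k))).intervalIntegrable

theorem coordPrimitive_sub (hg : ContinuousOn g (Metric.ball p δ))
    (hh : ContinuousOn h (Metric.ball p δ)) (hw : w ∈ Metric.ball p δ) :
    coordPrimitive p k (fun w => g w - h w) w =
      coordPrimitive p k g w - coordPrimitive p k h w :=
  intervalIntegral.integral_sub (intervalIntegrable_line hg hw k) (intervalIntegrable_line hh hw k)

theorem abs_coordPrimitive_le {K : ℝ} (hw : w ∈ Metric.closedBall p ε)
    (hK : ∀ w ∈ Metric.closedBall p ε, |h w| ≤ K) : |coordPrimitive p k h w| ≤ K * ε := by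
  have hwk : |w k - p k| ≤ ε := apply_mem_closedBall hw k
  have hK0 : 0 ≤ K := (abs_nonneg _).trans (hK w hw)
  refine le_trans ?_ (mul_le_mul_of_nonneg_left hwk hK0)
  refine intervalIntegral.norm_integral_le_of_norm_le_const
    (f := fun t => h (Function.update w k t)) fun t ht => ?_
  exact hK _ (update_mem_closedBall hw
    (uIcc_subset_closedBall (apply_mem_closedBall hw k) (Set.uIoc_subset_uIcc ht)))

theorem continuousOn_coordPrimitive (hh : ContinuousOn h (Metric.ball p δ)) :
    ContinuousOn (coordPrimitive p k h) (Metric.ball p δ) := by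
  intro w hw
  obtain ⟨ε, -, hε, hwε⟩ := exists_lt_mem_ball hw
  obtain ⟨g, hg, hgh⟩ := exists_continuous_eqOn_closedBall hh hε
  have hc : Continuous (coordPrimitive p k g) := by
    refine intervalIntegral.continuous_parametric_intervalIntegral_of_continuous
      (f := fun w t => g (Function.update w k t)) ?_ (continuous_apply k)
    exact hg.comp (continuous_fst.update k continuous_snd)
  refine (hc.continuousAt.congr ?_).continuousWithinAt
  filter_upwards [Metric.isOpen_ball.mem_nhds hwε] with v hv
  exact (coordPrimitive_congr_closedBall (Metric.ball_subset_closedBall hv) hgh).symm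

theorem hasPartialAt_coordPrimitive_self (hh : ContinuousOn h (Metric.ball p δ))
    (hw : w ∈ Metric.ball p δ) : HasPartialAt k (coordPrimitive p k h) (h w) w := by
  have hwk := apply_mem_ball hw k
  have hcont := continuousOn_line hh hw k
  have := intervalIntegral.integral_hasDerivAt_right (intervalIntegrable_line hh hw k)
    (hcont.stronglyMeasurableAtFilter Metric.isOpen_ball _ hwk)
    (hcont.continuousAt (Metric.isOpen_ball.mem_nhds hwk))
  simpa [HasPartialAt, coordPrimitive] using this

/-- Differentiation under the integral sign. -/
theorem hasPartialAt_coordPrimitive_of_ne {h' : (Fin n → ℝ) → ℝ} (hik : i ≠ k)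
    (hh : ContinuousOn h (Metric.ball p δ)) (hh' : ContinuousOn h' (Metric.ball p δ))
    (hp : ∀ w ∈ Metric.ball p δ, HasPartialAt i h (h' w) w) (hw : w ∈ Metric.ball p δ) :
    HasPartialAt i (coordPrimitive p k h) (coordPrimitive p k h' w) w := by
  obtain ⟨ε, -, hε, hwε⟩ := exists_lt_mem_ball hw
  obtain ⟨K, -, hK⟩ := exists_bound_closedBall hh' hε
  have hmem : ∀ x ∈ Metric.ball (p i) ε, ∀ t ∈ Set.uIcc (p k) (w k),
      Function.update (Function.update w i x) k t ∈ Metric.ball p ε := fun x hx t ht =>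
    update_mem_ball (update_mem_ball hwε hx) (uIcc_subset_ball (apply_mem_ball hwε k) ht)
  have hsub := Metric.ball_subset_ball (x := p) hε.le
  have hint : ∀ {f : (Fin n → ℝ) → ℝ}, ContinuousOn f (Metric.ball p δ) →
      ∀ x ∈ Metric.ball (p i) ε, IntervalIntegrable
        (fun t => f (Function.update (Function.update w i x) k t)) MeasureTheory.volume
        (p k) (w k) := fun hf x hx =>
    (hf.comp (continuous_update_line _ k).continuousOn
      fun t ht => hsub (hmem x hx t ht)).intervalIntegrable
  have hnhds : Metric.ball (p i) ε ∈ 𝓝 (w i) :=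
    Metric.isOpen_ball.mem_nhds (apply_mem_ball hwε i)
  have key := (intervalIntegral.hasDerivAt_integral_of_dominated_loc_of_deriv_le
    (μ := MeasureTheory.volume) (a := p k) (b := w k) (x₀ := w i)
    (F := fun x t => h (Function.update (Function.update w i x) k t))
    (F' := fun x t => h' (Function.update (Function.update w i x) k t)) (bound := fun _ => K)
    hnhds
    (by
      filter_upwards [hnhds] with x hx
      exact (intervalIntegrable_iff.1 (hint hh x hx)).aestronglyMeasurable)
    (hint hh _ (apply_mem_ball hwε i))
    (intervalIntegrable_iff.1 (hint hh' _ (apply_mem_ball hwε i))).aestronglyMeasurable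
    (Eventually.of_forall fun t ht x hx =>
      hK _ (Metric.ball_subset_closedBall (hmem x hx t (Set.uIoc_subset_uIcc ht))))
    intervalIntegrable_const
    (Eventually.of_forall fun t ht x hx => by
      have h1 := hp _ (hsub (hmem x hx t (Set.uIoc_subset_uIcc ht)))
      simp only [Function.update_comm hik] at h1 ⊢
      exact h1.hasDerivAt_update)).2
  simpa [HasPartialAt, coordPrimitive, hik.symm] using key

theorem coordPrimitive_invariant (hik : i ≠ k)
    (hinv : ∀ w ∈ Metric.ball p δ, ∀ t ∈ Metric.ball (p i) δ, h (Function.update w i t) = h w) :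
    ∀ w ∈ Metric.ball p δ, ∀ t ∈ Metric.ball (p i) δ,
      coordPrimitive p k h (Function.update w i t) = coordPrimitive p k h w := by
  intro w hw t ht
  simp only [coordPrimitive, Function.update_of_ne hik.symm]
  refine intervalIntegral.integral_congr fun s hs => ?_
  simp only [Function.update_comm hik]
  exact hinv _ (update_mem_ball hw (uIcc_subset_ball (apply_mem_ball hw k) hs)) _ ht

/-- The fundamental theorem of calculus along a coordinate line. -/
theorem eq_add_coordPrimitive {f : (Fin n → ℝ) → ℝ} (hh : ContinuousOn h (Metric.ball p δ))
    (hf : ∀ w ∈ Metric.ball p δ, HasPartialAt k f (h w) w) (hw : w ∈ Metric.ball p δ) :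
    f w = f (Function.update w k (p k)) + coordPrimitive p k h w := by
  have := intervalIntegral.integral_eq_sub_of_hasDerivAt
    (f := fun t => f (Function.update w k t)) (f' := fun t => h (Function.update w k t))
    (a := p k) (b := w k)
    (fun t ht => (hf _ (update_mem_ball hw
      (uIcc_subset_ball (apply_mem_ball hw k) ht))).hasDerivAt_update)
    (intervalIntegrable_line hh hw k)
  simp only [Function.update_eq_self] at this
  simp only [coordPrimitive]
  linarith

theorem contDiffOn_coordPrimitive_nat (N : ℕ) {h : (Fin n → ℝ) → ℝ}
    (hh : ContDiffOn ℝ N h (Metric.ball p δ)) :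
    ContDiffOn ℝ N (coordPrimitive p k h) (Metric.ball p δ) := by
  induction N generalizing h with
  | zero =>
    simp only [Nat.cast_zero, contDiffOn_zero] at hh ⊢
    exact continuousOn_coordPrimitive hh
  | succ N ih =>
    have hd : ∀ w ∈ Metric.ball p δ, DifferentiableAt ℝ h w := fun w hw =>
      (hh.differentiableOn (by simp)).differentiableAt (Metric.isOpen_ball.mem_nhds hw)
    have hfd : ∀ i : Fin n, ContDiffOn ℝ N (fun w => fderiv ℝ h w (Pi.single i 1))
        (Metric.ball p δ) := fun i =>
      (hh.fderiv_of_isOpen Metric.isOpen_ball (by push_cast; rfl)).clm_apply contDiffOn_const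
    refine contDiffOn_succ_of_hasPartialAt Metric.isOpen_ball (g := fun i => if i = k then h else
      coordPrimitive p k fun w => fderiv ℝ h w (Pi.single i 1)) (fun i w hw => ?_) fun i => ?_
    · split_ifs with hik
      · subst hik
        exact hasPartialAt_coordPrimitive_self hh.continuousOn hw
      · exact hasPartialAt_coordPrimitive_of_ne hik hh.continuousOn (hfd i).continuousOn
          (fun v hv => (hd v hv).hasPartialAt i) hw
    · split_ifs with hik
      · exact hh.of_le (by exact_mod_cast Nat.le_succ N)
      · exact ih (hfd i)

theorem contDiffOn_coordPrimitive {r : ℕ∞} (hh : ContDiffOn ℝ r h (Metric.ball p δ)) :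
    ContDiffOn ℝ r (coordPrimitive p k h) (Metric.ball p δ) :=
  contDiffOn_iff_forall_nat_le.2 fun N hN =>
    contDiffOn_coordPrimitive_nat N (contDiffOn_iff_forall_nat_le.1 hh N hN)

end Primitive

/-! ### Integrating factors -/

section Gauge

variable {n : ℕ} {p : Fin n → ℝ} {δ : ℝ} {r : ℕ∞}

theorem _root_.ContDiffOn.hasPartialAt_of_one_le {f : (Fin n → ℝ) → ℝ} (hr : 1 ≤ r)
    (hf : ContDiffOn ℝ r f (Metric.ball p δ)) {w : Fin n → ℝ} (hw : w ∈ Metric.ball p δ)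
    (i : Fin n) : HasPartialAt i f (fderiv ℝ f w (Pi.single i 1)) w :=
  ((hf.differentiableOn (by exact_mod_cast (zero_lt_one.trans_le hr).ne')).differentiableAt
    (Metric.isOpen_ball.mem_nhds hw)).hasPartialAt i

theorem _root_.ContDiffOn.continuousOn_partial {f : (Fin n → ℝ) → ℝ} (hr : 1 ≤ r)
    (hf : ContDiffOn ℝ r f (Metric.ball p δ)) (i : Fin n) :
    ContinuousOn (fun w => fderiv ℝ f w (Pi.single i 1)) (Metric.ball p δ) :=
  (hf.continuousOn_fderiv_of_isOpen Metric.isOpen_ball (by exact_mod_cast hr)).clm_apply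
    continuousOn_const

/-- If `∂_k A = ∂_a C`, the equations `∂_a log μ = A` and `∂_k log μ = C` have a common positive
solution `μ` on the cube. -/
theorem exists_integratingFactor {a k : Fin n} (hak : a ≠ k) (hr : 1 ≤ r)
    {A C : (Fin n → ℝ) → ℝ} (hA : ContDiffOn ℝ r A (Metric.ball p δ))
    (hC : ContDiffOn ℝ r C (Metric.ball p δ))
    (hAC : ∀ w ∈ Metric.ball p δ,
      fderiv ℝ A w (Pi.single k 1) = fderiv ℝ C w (Pi.single a 1)) :
    ∃ μ : (Fin n → ℝ) → ℝ, ContDiffOn ℝ r μ (Metric.ball p δ) ∧ (∀ w, 0 < μ w) ∧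
      (∀ w ∈ Metric.ball p δ, HasPartialAt a μ (A w * μ w) w) ∧
      ∀ w ∈ Metric.ball p δ, HasPartialAt k μ (C w * μ w) w := by
  have hupd : ContDiff ℝ r fun w : Fin n → ℝ => Function.update w a (p a) :=
    contDiff_pi.2 fun j => by
      rcases eq_or_ne j a with rfl | hj
      · simpa using contDiff_const
      · simpa [hj] using contDiff_apply ℝ ℝ j
  have hC0 : ContDiffOn ℝ r (fun w => C (Function.update w a (p a))) (Metric.ball p δ) :=
    hC.comp hupd.contDiffOn fun w hw => update_center_mem_ball hw a
  have hC0inv : ∀ w ∈ Metric.ball p δ, ∀ t ∈ Metric.ball (p a) δ,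
      C (Function.update (Function.update w a t) a (p a)) = C (Function.update w a (p a)) := by
    simp
  refine ⟨fun w => Real.exp (coordPrimitive p a A w +
    coordPrimitive p k (fun w => C (Function.update w a (p a))) w),
    Real.contDiff_exp.comp_contDiffOn
      ((contDiffOn_coordPrimitive hA).add (contDiffOn_coordPrimitive hC0)),
    fun w => Real.exp_pos _, fun w hw => ?_, fun w hw => ?_⟩
  · have h1 := (hasPartialAt_coordPrimitive_self (k := a) hA.continuousOn hw).add
      (hasPartialAt_zero_of_invariant hw (coordPrimitive_invariant
        (h := fun w => C (Function.update w a (p a))) hak hC0inv))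
    convert! h1.exp using 1
    ring
  · have h1 := (hasPartialAt_coordPrimitive_of_ne hak.symm hA.continuousOn
      (hA.continuousOn_partial hr k) (fun v hv => hA.hasPartialAt_of_one_le hr hv k) hw).add
      (hasPartialAt_coordPrimitive_self hC0.continuousOn hw)
    have h2 := eq_add_coordPrimitive (k := a) (hC.continuousOn_partial hr a)
      (fun v hv => hC.hasPartialAt_of_one_le hr hv a) hw
    rw [coordPrimitive_congr hw fun v hv => hAC v hv, add_comm, ← h2] at h1
    convert! h1.exp using 1
    ring

end Gauge

/-! ### The Goursat problem -/

section Goursat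

variable {n : ℕ} {p : Fin n → ℝ} {δ : ℝ} {j k : Fin n} {D G : (Fin n → ℝ) → ℝ}

/-- The Volterra operator which sends `U` to the iterated integral
`∫ D · (∫ G · U dw^j) dw^k`. -/
def goursatOp (p : Fin n → ℝ) (j k : Fin n) (D G U : (Fin n → ℝ) → ℝ) : (Fin n → ℝ) → ℝ :=
  coordPrimitive p k fun w => D w * coordPrimitive p j (fun w => G w * U w) w

theorem continuousOn_goursatOp (hD : ContinuousOn D (Metric.ball p δ))
    (hG : ContinuousOn G (Metric.ball p δ)) {U : (Fin n → ℝ) → ℝ}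
    (hU : ContinuousOn U (Metric.ball p δ)) :
    ContinuousOn (goursatOp p j k D G U) (Metric.ball p δ) :=
  continuousOn_coordPrimitive (hD.mul (continuousOn_coordPrimitive (hG.mul hU)))

theorem goursatOp_sub (hD : ContinuousOn D (Metric.ball p δ))
    (hG : ContinuousOn G (Metric.ball p δ)) {U V : (Fin n → ℝ) → ℝ}
    (hU : ContinuousOn U (Metric.ball p δ)) (hV : ContinuousOn V (Metric.ball p δ))
    {w : Fin n → ℝ} (hw : w ∈ Metric.ball p δ) :
    goursatOp p j k D G (fun w => U w - V w) w =
      goursatOp p j k D G U w - goursatOp p j k D G V w := by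
  rw [goursatOp, goursatOp, goursatOp, ← coordPrimitive_sub
    (hD.fun_mul (continuousOn_coordPrimitive (hG.fun_mul hU)))
    (hD.fun_mul (continuousOn_coordPrimitive (hG.fun_mul hV))) hw]
  refine coordPrimitive_congr hw fun v hv => ?_
  simp only [← mul_sub, ← coordPrimitive_sub (hG.fun_mul hU) (hG.fun_mul hV) hv]

/-- On a cube whose half-width is small compared with `D` and `G` the Volterra operator is a
contraction with constant `1 / 2` for the maximum norm of every concentric closed cube. -/
theorem abs_goursatOp_le {M : ℝ} (hMδ : M * δ ≤ 1 / 2)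
    (hDM : ∀ w ∈ Metric.ball p δ, |D w| ≤ M) (hGM : ∀ w ∈ Metric.ball p δ, |G w| ≤ M)
    {U : (Fin n → ℝ) → ℝ} {K ε : ℝ} (hε : ε < δ)
    (hU : ∀ w ∈ Metric.closedBall p ε, |U w| ≤ K) :
    ∀ w ∈ Metric.closedBall p ε, |goursatOp p j k D G U w| ≤ K / 2 := by
  intro w hw
  have hε0 : 0 ≤ ε := dist_nonneg.trans hw
  have hsub : ∀ {v}, v ∈ Metric.closedBall p ε → v ∈ Metric.ball p δ := fun hv =>
    Metric.closedBall_subset_ball hε hv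
  have hM : 0 ≤ M := (abs_nonneg _).trans (hDM w (hsub hw))
  have hK : 0 ≤ K := (abs_nonneg _).trans (hU w hw)
  have hMε : M * ε ≤ 1 / 2 := (mul_le_mul_of_nonneg_left hε.le hM).trans hMδ
  have hMε0 : 0 ≤ M * ε := mul_nonneg hM hε0
  have h1 : ∀ v ∈ Metric.closedBall p ε,
      |coordPrimitive p j (fun w => G w * U w) v| ≤ M * K * ε := fun v hv =>
    abs_coordPrimitive_le hv fun v hv => by
      rw [abs_mul]
      exact mul_le_mul (hGM v (hsub hv)) (hU v hv) (abs_nonneg _) hM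
  have h2 : |goursatOp p j k D G U w| ≤ M * (M * K * ε) * ε :=
    abs_coordPrimitive_le hw fun v hv => by
      rw [abs_mul]
      exact mul_le_mul (hDM v (hsub hv)) (h1 v hv) (abs_nonneg _) hM
  nlinarith [mul_le_mul hMε hMε hMε0 (by norm_num : (0 : ℝ) ≤ 1 / 2)]

/-- Uniqueness for the integral equation of the Goursat problem. -/
theorem eq_zero_of_eq_goursatOp {M : ℝ} (hMδ : M * δ ≤ 1 / 2)
    (hDM : ∀ w ∈ Metric.ball p δ, |D w| ≤ M) (hGM : ∀ w ∈ Metric.ball p δ, |G w| ≤ M)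
    {U : (Fin n → ℝ) → ℝ} (hU : ContinuousOn U (Metric.ball p δ))
    (heq : ∀ w ∈ Metric.ball p δ, U w = goursatOp p j k D G U w) :
    ∀ w ∈ Metric.ball p δ, U w = 0 := by
  intro w hw
  obtain ⟨ε, -, hε, hwε⟩ := exists_lt_mem_ball hw
  obtain ⟨K, -, hK⟩ := exists_bound_closedBall hU hε
  have key : ∀ N : ℕ, ∀ v ∈ Metric.closedBall p ε, |U v| ≤ K / 2 ^ N := by
    intro N
    induction N with
    | zero => simpa using hK
    | succ N ih =>
      intro v hv
      rw [heq v (Metric.closedBall_subset_ball hε hv), pow_succ, ← div_div]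
      exact abs_goursatOp_le hMδ hDM hGM hε ih v hv
  have hlim : Tendsto (fun N : ℕ => K / 2 ^ N) atTop (𝓝 0) := by
    have := (tendsto_pow_atTop_nhds_zero_of_lt_one (r := (1 / 2 : ℝ)) (by norm_num)
      (by norm_num)).const_mul K
    simpa [div_eq_mul_inv] using this
  exact abs_nonpos_iff.1
    (ge_of_tendsto' hlim fun N => key N w (Metric.ball_subset_closedBall hwε))

/-- Existence for the integral equation of the Goursat problem, by successive approximation. The
solution inherits from the data the independence of a coordinate `a`. -/
theorem exists_eq_add_goursatOp {M : ℝ} (hMδ : M * δ ≤ 1 / 2)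
    (hD : ContinuousOn D (Metric.ball p δ)) (hG : ContinuousOn G (Metric.ball p δ))
    (hDM : ∀ w ∈ Metric.ball p δ, |D w| ≤ M) (hGM : ∀ w ∈ Metric.ball p δ, |G w| ≤ M)
    {f : (Fin n → ℝ) → ℝ} (hf : ContinuousOn f (Metric.ball p δ)) {a : Fin n} (haj : a ≠ j)
    (hak : a ≠ k)
    (hDa : ∀ w ∈ Metric.ball p δ, ∀ t ∈ Metric.ball (p a) δ, D (Function.update w a t) = D w)
    (hGa : ∀ w ∈ Metric.ball p δ, ∀ t ∈ Metric.ball (p a) δ, G (Function.update w a t) = G w)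
    (hfa : ∀ w ∈ Metric.ball p δ, ∀ t ∈ Metric.ball (p a) δ, f (Function.update w a t) = f w) :
    ∃ U : (Fin n → ℝ) → ℝ, ContinuousOn U (Metric.ball p δ) ∧
      (∀ w ∈ Metric.ball p δ, U w = f w + goursatOp p j k D G U w) ∧
      ∀ w ∈ Metric.ball p δ, ∀ t ∈ Metric.ball (p a) δ, U (Function.update w a t) = U w := by
  let u : ℕ → (Fin n → ℝ) → ℝ := fun N =>
    Nat.rec f (fun _ v w => f w + goursatOp p j k D G v w) N
  have hu_succ : ∀ N w, u (N + 1) w = f w + goursatOp p j k D G (u N) w := fun _ _ => rfl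
  have hu_zero : u 0 = f := rfl
  clear_value u
  have hu : ∀ N, ContinuousOn (u N) (Metric.ball p δ) := by
    intro N
    induction N with
    | zero => rwa [hu_zero]
    | succ N ih =>
      exact (hf.fun_add (continuousOn_goursatOp hD hG ih)).congr fun w _ => hu_succ N w
  have hua : ∀ N, ∀ w ∈ Metric.ball p δ, ∀ t ∈ Metric.ball (p a) δ,
      u N (Function.update w a t) = u N w := by
    intro N
    induction N with
    | zero => rwa [hu_zero]
    | succ N ih =>
      intro w hw t ht
      rw [hu_succ, hu_succ, hfa w hw t ht]
      congr 1
      refine coordPrimitive_invariant hak (fun v hv s hs => ?_) w hw t ht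
      rw [hDa v hv s hs]
      congr 1
      refine coordPrimitive_invariant haj (fun v hv s hs => ?_) v hv s hs
      rw [hGa v hv s hs, ih v hv s hs]
  -- On every closed cube the successive differences decay geometrically.
  have hgeom : ∀ ε < δ, ∃ K, ∀ N, ∀ w ∈ Metric.closedBall p ε,
      dist (u N w) (u (N + 1) w) ≤ K / 2 / 2 ^ N := by
    intro ε hε
    obtain ⟨K, hK0, hK⟩ := exists_bound_closedBall (continuousOn_goursatOp hD hG hf (j := j)
      (k := k)) hε
    refine ⟨2 * K, fun N => ?_⟩
    induction N with
    | zero =>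
      intro w hw
      rw [dist_comm, Real.dist_eq, hu_succ]
      simpa [hu_zero] using hK w hw
    | succ N ih =>
      intro w hw
      have hwδ := Metric.closedBall_subset_ball hε hw
      rw [Real.dist_eq, hu_succ (N + 1), hu_succ N, add_sub_add_left_eq_sub,
        ← goursatOp_sub hD hG (hu _) (hu _) hwδ, pow_succ, ← div_div]
      exact abs_goursatOp_le hMδ hDM hGM hε ih w hw
  have hlim : ∀ w ∈ Metric.ball p δ, ∃ l, Tendsto (fun N => u N w) atTop (𝓝 l) := by
    intro w hw
    obtain ⟨ε, -, hε, hwε⟩ := exists_lt_mem_ball hw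
    obtain ⟨K, hK⟩ := hgeom ε hε
    exact cauchySeq_tendsto_of_complete
      (cauchySeq_of_le_geometric_two fun N => hK N w (Metric.ball_subset_closedBall hwε))
  choose! U hU using hlim
  have hdist : ∀ ε < δ, ∃ K, ∀ N, ∀ w ∈ Metric.closedBall p ε, |u N w - U w| ≤ K / 2 ^ N := by
    intro ε hε
    obtain ⟨K, hK⟩ := hgeom ε hε
    exact ⟨K, fun N w hw => dist_le_of_le_geometric_two_of_tendsto (fun N => hK N w hw)
      (hU w (Metric.closedBall_subset_ball hε hw)) N⟩
  have hpow : ∀ K : ℝ, Tendsto (fun N : ℕ => K / 2 ^ N) atTop (𝓝 0) := fun K => by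
    have := (tendsto_pow_atTop_nhds_zero_of_lt_one (r := (1 / 2 : ℝ)) (by norm_num)
      (by norm_num)).const_mul K
    simpa [div_eq_mul_inv] using this
  have hUc : ContinuousOn U (Metric.ball p δ) := by
    intro w hw
    obtain ⟨ε, -, hε, hwε⟩ := exists_lt_mem_ball hw
    obtain ⟨K, hK⟩ := hdist ε hε
    have hunif : TendstoUniformlyOn u U atTop (Metric.ball p ε) := by
      rw [Metric.tendstoUniformlyOn_iff]
      intro η hη
      filter_upwards [(hpow K).eventually_lt_const hη] with N hN v hv
      rw [dist_comm]
      exact (hK N v (Metric.ball_subset_closedBall hv)).trans_lt hN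
    have := hunif.continuousOn (Eventually.of_forall fun N =>
      (hu N).mono (Metric.ball_subset_ball hε.le)).frequently
    exact (this.continuousAt (Metric.isOpen_ball.mem_nhds hwε)).continuousWithinAt
  refine ⟨U, hUc, fun w hw => ?_, fun w hw t ht => ?_⟩
  · obtain ⟨ε, -, hε, hwε⟩ := exists_lt_mem_ball hw
    obtain ⟨K, hK⟩ := hdist ε hε
    have h1 : Tendsto (fun N => u (N + 1) w) atTop (𝓝 (f w + goursatOp p j k D G U w)) := by
      rw [tendsto_iff_dist_tendsto_zero]
      refine squeeze_zero (fun _ => dist_nonneg) (fun N => ?_) (hpow (K / 2))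
      rw [Real.dist_eq, hu_succ, add_sub_add_left_eq_sub, ← goursatOp_sub hD hG (hu _) hUc hw]
      have := abs_goursatOp_le (j := j) (k := k) hMδ hDM hGM hε (hK N) w
        (Metric.ball_subset_closedBall hwε)
      rwa [div_right_comm] at this
    exact tendsto_nhds_unique ((tendsto_add_atTop_iff_nat 1).2 (hU w hw)) h1
  · refine tendsto_nhds_unique (hU _ (update_mem_ball hw ht)) ?_
    simpa only [hua _ w hw t ht] using hU w hw

end Goursat

/-! ### The Darboux system -/

/-- The pair `(u, v)` solves on `V` the linear system
`∂_a u = A u`, `∂_a v = B v`, `∂_k u = C u - D v`, `∂_j v = E v - G u`. -/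
structure IsDarbouxSolution {n : ℕ} (a j k : Fin n) (A B C D E G : (Fin n → ℝ) → ℝ)
    (V : Set (Fin n → ℝ)) (u v : (Fin n → ℝ) → ℝ) : Prop where
  fst_a : ∀ w ∈ V, HasPartialAt a u (A w * u w) w
  snd_a : ∀ w ∈ V, HasPartialAt a v (B w * v w) w
  fst_k : ∀ w ∈ V, HasPartialAt k u (C w * u w - D w * v w) w
  snd_j : ∀ w ∈ V, HasPartialAt j v (E w * v w - G w * u w) w

section Darboux

variable {p : Fin 3 → ℝ} {δ : ℝ} {a j k : Fin 3} {r : ℕ∞}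

/-- One step of the regularity argument for `∂_a U = 0`, `∂_k U = D V`, `∂_j V = G U`.
Differentiation of the integral equation for `U` in the direction `j` gives an integral which
contains no derivative of `U` or `V`, since `∂_j V` may be replaced by `G U`; so all partial
derivatives of `U` are as regular as `U` and `V` themselves. -/
theorem contDiffOn_succ_of_goursat (haj : a ≠ j) (hak : a ≠ k) (hjk : j ≠ k) (hr : 1 ≤ r) {N : ℕ}
    (hN : ((N + 1 : ℕ) : ℕ∞) ≤ r) {D G U V f : (Fin 3 → ℝ) → ℝ}
    (hD : ContDiffOn ℝ r D (Metric.ball p δ)) (hG : ContDiffOn ℝ r G (Metric.ball p δ))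
    (hf : ContDiffOn ℝ r f (Metric.ball p δ))
    (hU : ContDiffOn ℝ N U (Metric.ball p δ)) (hV : ContDiffOn ℝ N V (Metric.ball p δ))
    (hUa : ∀ w ∈ Metric.ball p δ, HasPartialAt a U 0 w)
    (hUk : ∀ w ∈ Metric.ball p δ, HasPartialAt k U (D w * V w) w)
    (hVj : ∀ w ∈ Metric.ball p δ, HasPartialAt j V (G w * U w) w)
    (hUf : ∀ w ∈ Metric.ball p δ, U w = f w + coordPrimitive p k (fun w => D w * V w) w) :
    ContDiffOn ℝ (N + 1 : ℕ) U (Metric.ball p δ) := by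
  have hNr : ((N : ℕ) : WithTop ℕ∞) ≤ r := by
    have : ((N : ℕ) : ℕ∞) ≤ r := le_trans (by exact_mod_cast Nat.le_succ N) hN
    exact_mod_cast this
  have hpart : ∀ {h : (Fin 3 → ℝ) → ℝ}, ContDiffOn ℝ r h (Metric.ball p δ) →
      ContDiffOn ℝ N (fun w => fderiv ℝ h w (Pi.single j 1)) (Metric.ball p δ) := fun hh =>
    (hh.fderiv_of_isOpen Metric.isOpen_ball (by exact_mod_cast hN)).clm_apply contDiffOn_const
  have hN' : ContDiffOn ℝ N
      (fun w => fderiv ℝ D w (Pi.single j 1) * V w + D w * (G w * U w)) (Metric.ball p δ) :=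
    ((hpart hD).mul hV).add ((hD.of_le hNr).mul ((hG.of_le hNr).mul hU))
  have hUj : ∀ w ∈ Metric.ball p δ, HasPartialAt j U (fderiv ℝ f w (Pi.single j 1) +
      coordPrimitive p k
        (fun w => fderiv ℝ D w (Pi.single j 1) * V w + D w * (G w * U w)) w) w := by
    intro w hw
    refine ((hf.hasPartialAt_of_one_le hr hw j).add
      (hasPartialAt_coordPrimitive_of_ne hjk (hD.continuousOn.fun_mul hV.continuousOn)
        hN'.continuousOn (fun w hw => (hD.hasPartialAt_of_one_le hr hw j).mul (hVj w hw))
        hw)).congr_of_eventuallyEq ?_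
    filter_upwards [Metric.isOpen_ball.mem_nhds hw] with v hv using hUf v hv
  have hcases : ∀ i : Fin 3, i = a ∨ i = j ∨ i = k := by omega
  refine contDiffOn_succ_of_hasPartialAt Metric.isOpen_ball
    (g := fun i w => if i = a then 0 else if i = j then fderiv ℝ f w (Pi.single j 1) +
      coordPrimitive p k
        (fun w => fderiv ℝ D w (Pi.single j 1) * V w + D w * (G w * U w)) w
      else D w * V w) (fun i w hw => ?_) fun i => ?_
  · rcases hcases i with rfl | rfl | rfl
    · simpa using hUa w hw
    · simpa [haj.symm] using hUj w hw
    · simpa [hak.symm, hjk.symm] using hUk w hw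
  · rcases hcases i with rfl | rfl | rfl
    · simpa using contDiffOn_const
    · simpa [haj.symm] using (hpart hf).add (contDiffOn_coordPrimitive_nat N hN')
    · simpa [hak.symm, hjk.symm] using (hD.of_le hNr).mul hV

/-- Solvability of the Goursat problem for `∂_a U = ∂_a V = 0`, `∂_k U = D V`, `∂_j V = G U` on a
small cube, for coefficients and data of class `C^r` which do not depend on `w^a`. -/
theorem exists_goursat (haj : a ≠ j) (hak : a ≠ k) (hjk : j ≠ k) (hr : 1 ≤ r) {M : ℝ}
    (hMδ : M * δ ≤ 1 / 2) {D G f g : (Fin 3 → ℝ) → ℝ}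
    (hD : ContDiffOn ℝ r D (Metric.ball p δ)) (hG : ContDiffOn ℝ r G (Metric.ball p δ))
    (hDM : ∀ w ∈ Metric.ball p δ, |D w| ≤ M) (hGM : ∀ w ∈ Metric.ball p δ, |G w| ≤ M)
    (hDa : ∀ w ∈ Metric.ball p δ, ∀ t ∈ Metric.ball (p a) δ, D (Function.update w a t) = D w)
    (hGa : ∀ w ∈ Metric.ball p δ, ∀ t ∈ Metric.ball (p a) δ, G (Function.update w a t) = G w)
    (hf : ContDiffOn ℝ r f (Metric.ball p δ)) (hg : ContDiffOn ℝ r g (Metric.ball p δ))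
    (hfi : ∀ i ≠ j, ∀ w t, f (Function.update w i t) = f w)
    (hgi : ∀ i ≠ k, ∀ w t, g (Function.update w i t) = g w) :
    ∃ U V : (Fin 3 → ℝ) → ℝ, ContDiffOn ℝ r U (Metric.ball p δ) ∧
      ContDiffOn ℝ r V (Metric.ball p δ) ∧
      (∀ w ∈ Metric.ball p δ, HasPartialAt a U 0 w) ∧
      (∀ w ∈ Metric.ball p δ, HasPartialAt a V 0 w) ∧
      (∀ w ∈ Metric.ball p δ, HasPartialAt k U (D w * V w) w) ∧
      (∀ w ∈ Metric.ball p δ, HasPartialAt j V (G w * U w) w) ∧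
      (∀ w ∈ Metric.ball p δ, w k = p k → U w = f w) ∧
      ∀ w ∈ Metric.ball p δ, w j = p j → V w = g w := by
  have hDc := hD.continuousOn
  have hGc := hG.continuousOn
  have hfc := hf.continuousOn
  have hgc := hg.continuousOn
  obtain ⟨U, hUc, hUeq, hUa⟩ := exists_eq_add_goursatOp (j := j) (k := k) (a := a) hMδ hDc hGc
    hDM hGM (f := fun w => f w + coordPrimitive p k (fun w => D w * g w) w)
    (hfc.fun_add (continuousOn_coordPrimitive (hDc.fun_mul hgc))) haj hak hDa hGa
    (fun w hw t ht => by
      rw [hfi a haj, coordPrimitive_invariant hak (fun v hv s hs => ?_) w hw t ht]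
      rw [hDa v hv s hs, hgi a hak])
  let V : (Fin 3 → ℝ) → ℝ := fun w => g w + coordPrimitive p j (fun w => G w * U w) w
  have hVeq : ∀ w, V w = g w + coordPrimitive p j (fun w => G w * U w) w := fun _ => rfl
  have hVc : ContinuousOn V (Metric.ball p δ) :=
    hgc.fun_add (continuousOn_coordPrimitive (hGc.fun_mul hUc))
  have hUf : ∀ w ∈ Metric.ball p δ, U w = f w + coordPrimitive p k (fun w => D w * V w) w := by
    intro w hw
    have h1 := coordPrimitive_sub (k := k) (hDc.fun_mul hVc) (hDc.fun_mul hgc) hw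
    have h2 : coordPrimitive p k (fun w => D w * V w - D w * g w) w =
        goursatOp p j k D G U w :=
      coordPrimitive_congr hw fun v _ => by simp only [hVeq]; ring
    rw [hUeq w hw, ← h2, h1]
    ring
  have hUk : ∀ w ∈ Metric.ball p δ, HasPartialAt k U (D w * V w) w := by
    intro w hw
    have h1 := (hasPartialAt_zero_of_invariant hw
      (fun v _ t _ => hfi k hjk.symm v t)).add
      (hasPartialAt_coordPrimitive_self (hDc.fun_mul hVc) hw)
    rw [zero_add] at h1
    refine h1.congr_of_eventuallyEq ?_
    filter_upwards [Metric.isOpen_ball.mem_nhds hw] with v hv using hUf v hv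
  have hVj : ∀ w ∈ Metric.ball p δ, HasPartialAt j V (G w * U w) w := by
    intro w hw
    have h1 := (hasPartialAt_zero_of_invariant hw (fun v _ t _ => hgi j hjk v t)).add
      (hasPartialAt_coordPrimitive_self (hGc.fun_mul hUc) hw)
    rwa [zero_add] at h1
  have hVa : ∀ w ∈ Metric.ball p δ, HasPartialAt a V 0 w := fun w hw =>
    hasPartialAt_zero_of_invariant hw fun v hv t ht => by
      rw [hVeq, hVeq, hgi a hak, coordPrimitive_invariant haj (fun v hv s hs => ?_) v hv t ht]
      rw [hGa v hv s hs, hUa v hv s hs]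
  have hUa' : ∀ w ∈ Metric.ball p δ, HasPartialAt a U 0 w := fun w hw =>
    hasPartialAt_zero_of_invariant hw hUa
  have hreg : ∀ N : ℕ, (N : ℕ∞) ≤ r → ContDiffOn ℝ N U (Metric.ball p δ) ∧
      ContDiffOn ℝ N V (Metric.ball p δ) := by
    intro N
    induction N with
    | zero => intro _; simpa using ⟨hUc, hVc⟩
    | succ N ih =>
      intro hN
      obtain ⟨hU, hV⟩ := ih (le_trans (by exact_mod_cast Nat.le_succ N) hN)
      exact ⟨contDiffOn_succ_of_goursat haj hak hjk hr hN hD hG hf hU hV hUa' hUk hVj hUf,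
        contDiffOn_succ_of_goursat hak haj hjk.symm hr hN hG hD hg hV hU hVa hVj hUk
          fun w _ => hVeq w⟩
  refine ⟨U, V, contDiffOn_iff_forall_nat_le.2 fun N hN => (hreg N hN).1,
    contDiffOn_iff_forall_nat_le.2 fun N hN => (hreg N hN).2, hUa', hVa, hUk, hVj,
    fun w hw hwk => ?_, fun w hw hwj => ?_⟩
  · rw [hUf w hw, coordPrimitive, hwk]; simp
  · rw [hVeq w, coordPrimitive, hwj]; simp

/-- The Darboux system is well posed on small cubes: under the compatibility conditions that follow
from the equality of mixed derivatives, `u` may be prescribed along the `w^j`-line and `v` along the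
`w^k`-line through the centre, and these data determine the solution. Integrating factors remove the
coefficients `A`, `B`, `C`, `E`; what remains does not depend on `w^a` and is a Goursat problem in
the coordinates `w^j`, `w^k`. -/
theorem darboux_wellPosed (haj : a ≠ j) (hak : a ≠ k) (hjk : j ≠ k) (hr : 1 ≤ r) (hδ : 0 < δ)
    {A B C D E G : (Fin 3 → ℝ) → ℝ}
    (hA : ContDiffOn ℝ r A (Metric.ball p δ)) (hB : ContDiffOn ℝ r B (Metric.ball p δ))
    (hC : ContDiffOn ℝ r C (Metric.ball p δ)) (hD : ContDiffOn ℝ r D (Metric.ball p δ))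
    (hE : ContDiffOn ℝ r E (Metric.ball p δ)) (hG : ContDiffOn ℝ r G (Metric.ball p δ))
    (hAC : ∀ w ∈ Metric.ball p δ, fderiv ℝ A w (Pi.single k 1) = fderiv ℝ C w (Pi.single a 1))
    (hBE : ∀ w ∈ Metric.ball p δ, fderiv ℝ B w (Pi.single j 1) = fderiv ℝ E w (Pi.single a 1))
    (hDa : ∀ w ∈ Metric.ball p δ, fderiv ℝ D w (Pi.single a 1) = (A w - B w) * D w)
    (hGa : ∀ w ∈ Metric.ball p δ, fderiv ℝ G w (Pi.single a 1) = (B w - A w) * G w) :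
    ∃ δ₀, 0 < δ₀ ∧ δ₀ ≤ δ ∧ ∀ δ', 0 < δ' → δ' ≤ δ₀ →
      (∀ φ ψ : ℝ → ℝ, ContDiffOn ℝ r φ (Metric.ball (p j) δ') →
        ContDiffOn ℝ r ψ (Metric.ball (p k) δ') →
        ∃ u v : (Fin 3 → ℝ) → ℝ, ContDiffOn ℝ r u (Metric.ball p δ') ∧
          ContDiffOn ℝ r v (Metric.ball p δ') ∧
          IsDarbouxSolution a j k A B C D E G (Metric.ball p δ') u v ∧
          (∀ t ∈ Metric.ball (p j) δ', u (Function.update p j t) = φ t) ∧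
          ∀ t ∈ Metric.ball (p k) δ', v (Function.update p k t) = ψ t) ∧
      ∀ u v : (Fin 3 → ℝ) → ℝ, ContinuousOn u (Metric.ball p δ') →
        ContinuousOn v (Metric.ball p δ') →
        IsDarbouxSolution a j k A B C D E G (Metric.ball p δ') u v →
        (∀ t ∈ Metric.ball (p j) δ', u (Function.update p j t) = 0) →
        (∀ t ∈ Metric.ball (p k) δ', v (Function.update p k t) = 0) →
        ∀ w ∈ Metric.ball p δ', u w = 0 ∧ v w = 0 := by
  obtain ⟨l, hl, hl0, hla, hlk⟩ := exists_integratingFactor hak hr hA hC hAC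
  obtain ⟨μ, hμ, hμ0, hμa, hμj⟩ := exists_integratingFactor haj hr hB hE hBE
  have hl0' : ∀ w, l w ≠ 0 := fun w => (hl0 w).ne'
  have hμ0' : ∀ w, μ w ≠ 0 := fun w => (hμ0 w).ne'
  let D' : (Fin 3 → ℝ) → ℝ := fun w => -(D w) * μ w / l w
  let G' : (Fin 3 → ℝ) → ℝ := fun w => -(G w) * l w / μ w
  have hD'w : ∀ w, D' w = -(D w) * μ w / l w := fun _ => rfl
  have hG'w : ∀ w, G' w = -(G w) * l w / μ w := fun _ => rfl
  have hD' : ContDiffOn ℝ r D' (Metric.ball p δ) := (hD.neg.mul hμ).div hl fun w _ => hl0' w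
  have hG' : ContDiffOn ℝ r G' (Metric.ball p δ) := (hG.neg.mul hl).div hμ fun w _ => hμ0' w
  have hD'a : ∀ w ∈ Metric.ball p δ, HasPartialAt a D' 0 w := by
    intro w hw
    have h1 := hD.neg.hasPartialAt_of_one_le hr hw a
    rw [fderiv_fun_neg, neg_apply, hDa w hw] at h1
    convert! (h1.mul (hμa w hw)).div (hla w hw) (hl0' w) using 1
    field_simp [hl0' w]
    ring
  have hG'a : ∀ w ∈ Metric.ball p δ, HasPartialAt a G' 0 w := by
    intro w hw
    have h1 := hG.neg.hasPartialAt_of_one_le hr hw a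
    rw [fderiv_fun_neg, neg_apply, hGa w hw] at h1
    convert! (h1.mul (hla w hw)).div (hμa w hw) (hμ0' w) using 1
    field_simp [hμ0' w]
    ring
  clear_value D' G'
  -- A bound for the reduced coefficients near the centre decides how small the cubes have to be.
  obtain ⟨M, hM0, δ₀, hδ₀, hδ₀δ, hMδ₀, hM⟩ : ∃ M, 0 < M ∧ ∃ δ₀, 0 < δ₀ ∧ δ₀ ≤ δ ∧
      M * δ₀ ≤ 1 / 2 ∧ ∀ w ∈ Metric.ball p δ₀, |D' w| ≤ M ∧ |G' w| ≤ M := by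
    have hp : Metric.ball p δ ∈ 𝓝 p := Metric.ball_mem_nhds p hδ
    have hDc := (hD'.continuousOn.continuousAt hp).abs
    have hGc := (hG'.continuousOn.continuousAt hp).abs
    have hM0 : 0 < max |D' p| |G' p| + 1 := by positivity
    obtain ⟨ε, hε, hball⟩ := Metric.eventually_nhds_iff_ball.1
      ((hDc.eventually_lt_const (show |D' p| < max |D' p| |G' p| + 1 from
        (le_max_left _ _).trans_lt (lt_add_one _))).and
      (hGc.eventually_lt_const (show |G' p| < max |D' p| |G' p| + 1 from
        (le_max_right _ _).trans_lt (lt_add_one _))))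
    refine ⟨_, hM0, min (min δ ε) (1 / (2 * (max |D' p| |G' p| + 1))), by positivity,
      (min_le_left _ _).trans (min_le_left _ _), ?_, fun w hw => ?_⟩
    · refine (mul_le_mul_of_nonneg_left (min_le_right _ _) hM0.le).trans (le_of_eq ?_)
      field_simp
    · have := hball w (Metric.ball_subset_ball ((min_le_left _ _).trans (min_le_right _ _)) hw)
      exact ⟨this.1.le, this.2.le⟩
  refine ⟨δ₀, hδ₀, hδ₀δ, fun δ' hδ' hδ'₀ => ?_⟩
  have hsub : Metric.ball p δ' ⊆ Metric.ball p δ := Metric.ball_subset_ball (hδ'₀.trans hδ₀δ)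
  have hMδ' : M * δ' ≤ 1 / 2 := (mul_le_mul_of_nonneg_left hδ'₀ hM0.le).trans hMδ₀
  have hDM : ∀ w ∈ Metric.ball p δ', |D' w| ≤ M := fun w hw =>
    (hM w (Metric.ball_subset_ball hδ'₀ hw)).1
  have hGM : ∀ w ∈ Metric.ball p δ', |G' w| ≤ M := fun w hw =>
    (hM w (Metric.ball_subset_ball hδ'₀ hw)).2
  have hline : ∀ i : Fin 3, ContDiff ℝ r fun w : Fin 3 → ℝ => Function.update p i (w i) :=
    fun i => (contDiff_update r p i).comp (contDiff_apply ℝ ℝ i)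
  constructor
  · intro φ ψ hφ hψ
    have hdata : ∀ (i : Fin 3) (χ : ℝ → ℝ) (ν : (Fin 3 → ℝ) → ℝ),
        ContDiffOn ℝ r χ (Metric.ball (p i) δ') → ContDiffOn ℝ r ν (Metric.ball p δ) →
        (∀ w, ν w ≠ 0) → ContDiffOn ℝ r (fun w => χ (w i) / ν (Function.update p i (w i)))
          (Metric.ball p δ') := fun i χ ν hχ hν hν0 =>
      (hχ.comp (contDiff_apply ℝ ℝ i).contDiffOn fun w hw => apply_mem_ball hw i).div
        (hν.comp (hline i).contDiffOn fun w hw => hsub (line_mem_ball (apply_mem_ball hw i)))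
        fun w _ => hν0 _
    obtain ⟨U, V, hU, hV, hUa, hVa, hUk, hVj, hUf, hVg⟩ := exists_goursat haj hak hjk hr hMδ'
      (hD'.mono hsub) (hG'.mono hsub) hDM hGM
      (invariant_of_hasPartialAt_zero fun w hw => hD'a w (hsub hw))
      (invariant_of_hasPartialAt_zero fun w hw => hG'a w (hsub hw))
      (hdata j φ l hφ hl hl0') (hdata k ψ μ hψ hμ hμ0')
      (fun i hi w t => by simp [hi.symm]) (fun i hi w t => by simp [hi.symm])
    refine ⟨fun w => l w * U w, fun w => μ w * V w, (hl.mono hsub).mul hU, (hμ.mono hsub).mul hV,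
      ⟨fun w hw => ?_, fun w hw => ?_, fun w hw => ?_, fun w hw => ?_⟩, fun t ht => ?_,
      fun t ht => ?_⟩
    · convert! (hla w (hsub hw)).mul (hUa w hw) using 1
      ring
    · convert! (hμa w (hsub hw)).mul (hVa w hw) using 1
      ring
    · convert! (hlk w (hsub hw)).mul (hUk w hw) using 1
      rw [hD'w]
      field_simp [hl0' w]
      ring
    · convert! (hμj w (hsub hw)).mul (hVj w hw) using 1
      rw [hG'w]
      field_simp [hμ0' w]
      ring
    · simp only
      rw [hUf _ (line_mem_ball ht) (by simp [hjk.symm])]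
      simp only [Function.update_self]
      field_simp [hl0' (Function.update p j t)]
    · simp only
      rw [hVg _ (line_mem_ball ht) (by simp [hjk])]
      simp only [Function.update_self]
      field_simp [hμ0' (Function.update p k t)]
  · intro u v hu hv hsol hu0 hv0
    have hU : ContinuousOn (fun w => u w / l w) (Metric.ball p δ') :=
      hu.div (hl.continuousOn.mono hsub) fun w _ => hl0' w
    have hV : ContinuousOn (fun w => v w / μ w) (Metric.ball p δ') :=
      hv.div (hμ.continuousOn.mono hsub) fun w _ => hμ0' w
    have hUa : ∀ w ∈ Metric.ball p δ', HasPartialAt a (fun w => u w / l w) 0 w := by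
      intro w hw
      convert! (hsol.fst_a w hw).div (hla w (hsub hw)) (hl0' w) using 1
      field_simp [hl0' w]
      ring
    have hVa : ∀ w ∈ Metric.ball p δ', HasPartialAt a (fun w => v w / μ w) 0 w := by
      intro w hw
      convert! (hsol.snd_a w hw).div (hμa w (hsub hw)) (hμ0' w) using 1
      field_simp [hμ0' w]
      ring
    have hUk : ∀ w ∈ Metric.ball p δ',
        HasPartialAt k (fun w => u w / l w) (D' w * (v w / μ w)) w := by
      intro w hw
      convert! (hsol.fst_k w hw).div (hlk w (hsub hw)) (hl0' w) using 1
      rw [hD'w]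
      field_simp [hl0' w, hμ0' w]
      ring
    have hVj : ∀ w ∈ Metric.ball p δ',
        HasPartialAt j (fun w => v w / μ w) (G' w * (u w / l w)) w := by
      intro w hw
      convert! (hsol.snd_j w hw).div (hμj w (hsub hw)) (hμ0' w) using 1
      rw [hG'w]
      field_simp [hl0' w, hμ0' w]
      ring
    -- On the hyperplanes through the centre the quotients equal their values on the data lines.
    have hUeq : ∀ w ∈ Metric.ball p δ', u w / l w =
        coordPrimitive p k (fun w => D' w * (v w / μ w)) w := by
      intro w hw
      rw [eq_add_coordPrimitive (f := fun w => u w / l w) (k := k)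
        ((hD'.continuousOn.mono hsub).fun_mul hV) hUk hw, add_eq_right]
      have hwk := update_center_mem_ball hw k
      have h1 := invariant_of_hasPartialAt_zero hUa _ hwk (p a) (Metric.mem_ball_self hδ')
      have h2 : Function.update (Function.update w k (p k)) a (p a) =
          Function.update p j (w j) := by
        have hcases : ∀ i : Fin 3, i = a ∨ i = j ∨ i = k := by omega
        funext i
        rcases hcases i with rfl | rfl | rfl <;>
          simp [haj, haj.symm, hak.symm, hjk, hjk.symm]
      rw [h2, hu0 _ (apply_mem_ball hw j)] at h1
      simpa using h1.symm
    have hVeq : ∀ w ∈ Metric.ball p δ', v w / μ w =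
        coordPrimitive p j (fun w => G' w * (u w / l w)) w := by
      intro w hw
      rw [eq_add_coordPrimitive (f := fun w => v w / μ w) (k := j)
        ((hG'.continuousOn.mono hsub).fun_mul hU) hVj hw, add_eq_right]
      have hwj := update_center_mem_ball hw j
      have h1 := invariant_of_hasPartialAt_zero hVa _ hwj (p a) (Metric.mem_ball_self hδ')
      have h2 : Function.update (Function.update w j (p j)) a (p a) =
          Function.update p k (w k) := by
        have hcases : ∀ i : Fin 3, i = a ∨ i = j ∨ i = k := by omega
        funext i
        rcases hcases i with rfl | rfl | rfl <;>
          simp [haj.symm, hak, hak.symm, hjk, hjk.symm]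
      rw [h2, hv0 _ (apply_mem_ball hw k)] at h1
      simpa using h1.symm
    have hU0 : ∀ w ∈ Metric.ball p δ', u w / l w = 0 := by
      refine eq_zero_of_eq_goursatOp (j := j) (k := k) hMδ' hDM hGM hU fun w hw => ?_
      rw [hUeq w hw]
      exact coordPrimitive_congr hw fun v hv => by simp only [hVeq v hv]
    have hV0 : ∀ w ∈ Metric.ball p δ', v w / μ w = 0 := by
      intro w hw
      rw [hVeq w hw, coordPrimitive_congr (h := fun _ => 0) hw fun v hv => by simp [hU0 v hv]]
      simp [coordPrimitive]
    exact fun w hw => ⟨by simpa [hl0' w] using hU0 w hw, by simpa [hμ0' w] using hV0 w hw⟩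

end Darboux

/-! ### The connection in Riemann coordinates -/

section Connection

variable {n : ℕ} {m r : ℕ∞} {R : Fin n → (Fin n → ℝ) → (Fin n → ℝ)}
  {ρ : OpenPartialHomeomorph (Fin n → ℝ) (Fin n → ℝ)} {u w : Fin n → ℝ}

theorem IsRiemannCoordinates.differentiableAt (hρ : IsRiemannCoordinates (m + 1) R ρ)
    (hu : u ∈ ρ.source) : DifferentiableAt ℝ ρ u :=
  (hρ.contDiffOn.differentiableOn (by simp)).differentiableAt (ρ.open_source.mem_nhds hu)

theorem IsRiemannCoordinates.fderiv_normalizedFrame (hρ : IsRiemannCoordinates (m + 1) R ρ)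
    (hu : u ∈ ρ.source) (j : Fin n) :
    fderiv ℝ ρ u (normalizedFrame R ρ j u) = Pi.single j 1 := by
  funext i
  rw [normalizedFrame, map_smul, Pi.smul_apply, smul_eq_mul]
  rcases eq_or_ne i j with rfl | hij
  · simpa [alongFrame] using inv_mul_cancel₀ (hρ.diag i u hu)
  · have := hρ.off_diag i j hij u hu
    rw [alongFrame] at this
    simp [this, hij]

theorem IsRiemannCoordinates.exists_equiv (hρ : IsRiemannCoordinates (m + 1) R ρ)
    (hu : u ∈ ρ.source) :
    ∃ L : (Fin n → ℝ) ≃L[ℝ] (Fin n → ℝ), (L : (Fin n → ℝ) →L[ℝ] (Fin n → ℝ)) = fderiv ℝ ρ u := by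
  have hsurj : Function.Surjective (fderiv ℝ ρ u : (Fin n → ℝ) →ₗ[ℝ] (Fin n → ℝ)) := by
    intro y
    refine ⟨∑ j, y j • normalizedFrame R ρ j u, ?_⟩
    simp only [map_sum, map_smul, ContinuousLinearMap.coe_coe, hρ.fderiv_normalizedFrame hu]
    funext i
    simp [Finset.sum_apply, Pi.single_apply]
  have hinj := LinearMap.injective_iff_surjective.2 hsurj
  refine ⟨(LinearEquiv.ofBijective _ ⟨hinj, hsurj⟩).toContinuousLinearEquiv, ?_⟩
  ext
  rfl

theorem IsRiemannCoordinates.contDiffOn_symm (hρ : IsRiemannCoordinates (m + 1) R ρ) :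
    ContDiffOn ℝ (m + 1 : ℕ∞) ρ.symm ρ.target := by
  intro w hw
  have hu := ρ.map_target hw
  obtain ⟨L, hL⟩ := hρ.exists_equiv hu
  refine (ρ.contDiffAt_symm hw (f₀' := L) ?_ ?_).contDiffWithinAt
  · rw [hL]
    exact (hρ.differentiableAt hu).hasFDerivAt
  · exact hρ.contDiffOn.contDiffAt (ρ.open_source.mem_nhds hu)

theorem IsRiemannCoordinates.differentiableAt_symm (hρ : IsRiemannCoordinates (m + 1) R ρ)
    (hw : w ∈ ρ.target) : DifferentiableAt ℝ ρ.symm w :=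
  (hρ.contDiffOn_symm.differentiableOn (by simp)).differentiableAt (ρ.open_target.mem_nhds hw)

theorem IsRiemannCoordinates.fderiv_symm_fderiv (hρ : IsRiemannCoordinates (m + 1) R ρ)
    (hw : w ∈ ρ.target) (v : Fin n → ℝ) :
    fderiv ℝ ρ.symm w (fderiv ℝ ρ (ρ.symm w) v) = v := by
  have hu := ρ.map_target hw
  have h1 : HasFDerivAt ρ.symm (fderiv ℝ ρ.symm w) (ρ (ρ.symm w)) := by
    rw [ρ.right_inv hw]
    exact (hρ.differentiableAt_symm hw).hasFDerivAt
  have h2 := h1.comp (ρ.symm w) (hρ.differentiableAt hu).hasFDerivAt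
  have h3 : HasFDerivAt (ρ.symm ∘ ρ) (ContinuousLinearMap.id ℝ (Fin n → ℝ)) (ρ.symm w) :=
    (hasFDerivAt_id _).congr_of_eventuallyEq (by
      filter_upwards [ρ.open_source.mem_nhds hu] with v hv using ρ.left_inv hv)
  simpa using congrArg (fun L => L v) (h2.unique h3)

/-- The coordinate vector field `∂ / ∂ w^j`, as a function of the coordinates `w`. -/
def coordField (ρ : OpenPartialHomeomorph (Fin n → ℝ) (Fin n → ℝ)) (j : Fin n) (w : Fin n → ℝ) :
    Fin n → ℝ :=
  fderiv ℝ ρ.symm w (Pi.single j 1)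

theorem IsRiemannCoordinates.normalizedFrame_symm (hρ : IsRiemannCoordinates (m + 1) R ρ)
    (hw : w ∈ ρ.target) (j : Fin n) :
    normalizedFrame R ρ j (ρ.symm w) = coordField ρ j w := by
  rw [coordField, ← hρ.fderiv_normalizedFrame (ρ.map_target hw) j, hρ.fderiv_symm_fderiv hw]

theorem IsRiemannCoordinates.fderiv_coordField_eq (hρ : IsRiemannCoordinates (m + 1) R ρ)
    (hw : w ∈ ρ.target) (j : Fin n) :
    fderiv ℝ ρ (ρ.symm w) (coordField ρ j w) = Pi.single j 1 := by
  rw [← hρ.normalizedFrame_symm hw, hρ.fderiv_normalizedFrame (ρ.map_target hw)]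

theorem IsRiemannCoordinates.contDiffOn_coordField (hρ : IsRiemannCoordinates (m + 1) R ρ)
    (j : Fin n) : ContDiffOn ℝ m (coordField ρ j) ρ.target :=
  (hρ.contDiffOn_symm.fderiv_of_isOpen ρ.open_target (by push_cast; rfl)).clm_apply
    contDiffOn_const

/-- The rows of the coframe matrix of the coordinate fields are the differentials `dw^k`. -/
theorem IsRiemannCoordinates.coframeMatrix_mulVec (hρ : IsRiemannCoordinates (m + 1) R ρ)
    (hu : u ∈ ρ.source) (v : Fin n → ℝ) :
    (coframeMatrix (normalizedFrame R ρ) u).mulVec v = fderiv ℝ ρ u v := by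
  have h : LinearMap.toMatrix' (fderiv ℝ ρ u : (Fin n → ℝ) →ₗ[ℝ] (Fin n → ℝ)) *
      frameMatrix (normalizedFrame R ρ) u = 1 := by
    ext i j
    have := congrFun (hρ.fderiv_normalizedFrame hu j) i
    rw [← ContinuousLinearMap.coe_coe, ← LinearMap.toMatrix'_mulVec] at this
    rw [Matrix.mul_apply_eq_vecMul, Matrix.one_apply]
    simpa [Matrix.mulVec, Matrix.vecMul, dotProduct, frameMatrix, Pi.single_apply] using this
  rw [coframeMatrix, Matrix.inv_eq_left_inv h, LinearMap.toMatrix'_mulVec]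
  rfl

theorem IsRiemannCoordinates.differentiableAt_coordField (hρ : IsRiemannCoordinates (m + 1) R ρ)
    (hm : 1 ≤ m) (hw : w ∈ ρ.target) (j : Fin n) : DifferentiableAt ℝ (coordField ρ j) w :=
  ((hρ.contDiffOn_coordField j).differentiableOn
    (by exact_mod_cast (zero_lt_one.trans_le hm).ne')).differentiableAt (ρ.open_target.mem_nhds hw)

theorem IsRiemannCoordinates.hasFDerivAt_normalizedFrame (hρ : IsRiemannCoordinates (m + 1) R ρ)
    (hm : 1 ≤ m) (hu : u ∈ ρ.source) (j : Fin n) :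
    HasFDerivAt (normalizedFrame R ρ j)
      ((fderiv ℝ (coordField ρ j) (ρ u)).comp (fderiv ℝ ρ u)) u := by
  refine ((hρ.differentiableAt_coordField hm (ρ.map_source hu) j).hasFDerivAt.comp u
    (hρ.differentiableAt hu).hasFDerivAt).congr_of_eventuallyEq ?_
  filter_upwards [ρ.open_source.mem_nhds hu] with v hv
  rw [Function.comp_apply, ← hρ.normalizedFrame_symm (ρ.map_source hv), ρ.left_inv hv]

theorem IsRiemannCoordinates.riemannCoeff_eq (hρ : IsRiemannCoordinates (m + 1) R ρ)
    (hm : 1 ≤ m) (hw : w ∈ ρ.target) (i j k : Fin n) :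
    riemannCoeff R ρ i j k w =
      fderiv ℝ ρ (ρ.symm w) (fderiv ℝ (coordField ρ j) w (Pi.single i 1)) k := by
  have hu := ρ.map_target hw
  rw [riemannCoeff, christoffel, hρ.coframeMatrix_mulVec hu,
    (hρ.hasFDerivAt_normalizedFrame hm hu j).fderiv, ContinuousLinearMap.comp_apply,
    hρ.fderiv_normalizedFrame hu, ρ.right_inv hw]

theorem IsRiemannCoordinates.fderiv_coordField (hρ : IsRiemannCoordinates (m + 1) R ρ)
    (hm : 1 ≤ m) (hw : w ∈ ρ.target) (i j : Fin n) :
    fderiv ℝ (coordField ρ j) w (Pi.single i 1) =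
      ∑ k, riemannCoeff R ρ i j k w • coordField ρ k w := by
  have h : fderiv ℝ ρ (ρ.symm w) (fderiv ℝ (coordField ρ j) w (Pi.single i 1)) =
      ∑ k, riemannCoeff R ρ i j k w • Pi.single k (1 : ℝ) := by
    funext q
    rw [← hρ.riemannCoeff_eq hm hw]
    simp [Finset.sum_apply, Pi.single_apply]
  rw [← hρ.fderiv_symm_fderiv hw (fderiv ℝ (coordField ρ j) w (Pi.single i 1)), h]
  simp [coordField]

/-- The connection is torsion free, and the coordinate fields commute. -/
theorem IsRiemannCoordinates.riemannCoeff_symm (hρ : IsRiemannCoordinates (m + 1) R ρ)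
    (hm : 1 ≤ m) (hw : w ∈ ρ.target) (i j k : Fin n) :
    riemannCoeff R ρ i j k w = riemannCoeff R ρ j i k w := by
  have hcd : ContDiffAt ℝ (m + 1 : ℕ∞) ρ.symm w :=
    hρ.contDiffOn_symm.contDiffAt (ρ.open_target.mem_nhds hw)
  have h2 : minSmoothness ℝ 2 ≤ ((m + 1 : ℕ∞) : WithTop ℕ∞) := by
    rw [minSmoothness_of_isRCLikeNormedField]
    have : (2 : ℕ∞) ≤ m + 1 := by
      rw [← one_add_one_eq_two]
      gcongr
    exact WithTop.coe_le_coe.2 this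
  have hdiff : DifferentiableAt ℝ (fderiv ℝ ρ.symm) w :=
    ((hρ.contDiffOn_symm.fderiv_of_isOpen (m := m) ρ.open_target
      (by push_cast; rfl)).differentiableOn
      (by exact_mod_cast (zero_lt_one.trans_le hm).ne')).differentiableAt
      (ρ.open_target.mem_nhds hw)
  have key : ∀ i j : Fin n, fderiv ℝ (coordField ρ j) w (Pi.single i 1) =
      fderiv ℝ (fderiv ℝ ρ.symm) w (Pi.single i 1) (Pi.single j 1) := by
    intro i j
    have := (hdiff.hasFDerivAt.clm_apply (hasFDerivAt_const (Pi.single j (1 : ℝ)) w)).fderiv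
    change fderiv ℝ (fun w => fderiv ℝ ρ.symm w (Pi.single j 1)) w _ = _
    rw [this]
    simp
  rw [hρ.riemannCoeff_eq hm hw, hρ.riemannCoeff_eq hm hw, key, key,
    (hcd.isSymmSndFDerivAt h2).eq]

theorem IsRiemannCoordinates.contDiffOn_riemannCoeff (hρ : IsRiemannCoordinates (m + 1) R ρ)
    (hrm : r + 1 ≤ m) (i j k : Fin n) : ContDiffOn ℝ r (riemannCoeff R ρ i j k) ρ.target := by
  have hm : 1 ≤ m := le_add_self.trans hrm
  have hrm' : r ≤ m := le_self_add.trans hrm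
  have h1 : ContDiffOn ℝ r (fun w => fderiv ℝ ρ (ρ.symm w)) ρ.target :=
    ((hρ.contDiffOn.fderiv_of_isOpen (m := m) ρ.open_source (by push_cast; rfl)).of_le
      (by exact_mod_cast hrm')).comp
      (hρ.contDiffOn_symm.of_le (by exact_mod_cast hrm'.trans le_self_add))
      fun w hw => ρ.map_target hw
  have h2 : ContDiffOn ℝ r (fun w => fderiv ℝ (coordField ρ j) w (Pi.single i 1)) ρ.target :=
    ((hρ.contDiffOn_coordField j).fderiv_of_isOpen ρ.open_target
      (by exact_mod_cast hrm)).clm_apply contDiffOn_const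
  exact ((contDiff_apply ℝ ℝ k).comp_contDiffOn (h1.clm_apply h2)).congr fun w hw =>
    hρ.riemannCoeff_eq hm hw i j k

/-- The connection is flat: its curvature, expressed by the coefficients in Riemann coordinates,
vanishes. -/
theorem IsRiemannCoordinates.flatness (hρ : IsRiemannCoordinates (m + 1) R ρ)
    (hm : 1 + 1 ≤ m) (hw : w ∈ ρ.target) (l i j q : Fin n) :
    fderiv ℝ (riemannCoeff R ρ i j q) w (Pi.single l 1) +
        ∑ k, riemannCoeff R ρ i j k w * riemannCoeff R ρ l k q w =
      fderiv ℝ (riemannCoeff R ρ l j q) w (Pi.single i 1) +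
        ∑ k, riemannCoeff R ρ l j k w * riemannCoeff R ρ i k q w := by
  have hm1 : 1 ≤ m := le_add_self.trans hm
  have hnhds := ρ.open_target.mem_nhds hw
  have hZ : ∀ i j k, DifferentiableAt ℝ (riemannCoeff R ρ i j k) w := fun i j k =>
    ((hρ.contDiffOn_riemannCoeff hm i j k).differentiableOn (by simp)).differentiableAt hnhds
  have hcd : ContDiffAt ℝ m (coordField ρ j) w := (hρ.contDiffOn_coordField j).contDiffAt hnhds
  have h2 : minSmoothness ℝ 2 ≤ (m : WithTop ℕ∞) := by
    rw [minSmoothness_of_isRCLikeNormedField]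
    rw [one_add_one_eq_two] at hm
    exact WithTop.coe_le_coe.2 hm
  have hdiff : DifferentiableAt ℝ (fderiv ℝ (coordField ρ j)) w :=
    (((hρ.contDiffOn_coordField j).fderiv_of_isOpen (m := 1) ρ.open_target
      (WithTop.coe_le_coe.2 hm)).differentiableOn (by simp)).differentiableAt hnhds
  have key : ∀ l i : Fin n, fderiv ℝ ρ (ρ.symm w)
      (fderiv ℝ (fderiv ℝ (coordField ρ j)) w (Pi.single l 1) (Pi.single i 1)) q =
      fderiv ℝ (riemannCoeff R ρ i j q) w (Pi.single l 1) +
        ∑ k, riemannCoeff R ρ i j k w * riemannCoeff R ρ l k q w := by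
    intro l i
    have h3 := hdiff.hasFDerivAt.clm_apply (hasFDerivAt_const (Pi.single i (1 : ℝ)) w)
    have h4 : HasFDerivAt (fun w => ∑ k, riemannCoeff R ρ i j k w • coordField ρ k w) _ w :=
      HasFDerivAt.fun_sum fun k _ => (hZ i j k).hasFDerivAt.smul
        (hρ.differentiableAt_coordField hm1 hw k).hasFDerivAt
    have h5 := h3.unique (h4.congr_of_eventuallyEq (by
      filter_upwards [hnhds] with v hv using hρ.fderiv_coordField hm1 hv i j))
    have h6 := congrArg (fun L => fderiv ℝ ρ (ρ.symm w) (L (Pi.single l 1)) q) h5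
    simp only [ContinuousLinearMap.comp_zero, zero_add, ContinuousLinearMap.flip_apply,
      sum_apply, map_sum, add_apply, map_add,
      smul_apply, map_smul, ContinuousLinearMap.smulRight_apply,
      hρ.fderiv_coordField_eq hw, Finset.sum_apply, Pi.add_apply, Pi.smul_apply, smul_eq_mul,
      Finset.sum_add_distrib, ← hρ.riemannCoeff_eq hm1 hw] at h6
    rw [h6, add_comm]
    simp [Pi.single_apply]
  rw [← key, ← key, (hcd.isSymmSndFDerivAt h2).eq]

end Connection

/-! ### Regular points -/

section Regular

variable {n : ℕ} {f g : (Fin n → ℝ) → ℝ} {p : Fin n → ℝ}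

theorem IsRegularAt.eventually (h : IsRegularAt f p) : ∀ᶠ q in 𝓝 p, IsRegularAt f q := by
  rcases h with h | h
  · filter_upwards [h.eventually_nhds] with q hq using Or.inl hq
  · filter_upwards [h.eventually_nhds] with q hq using Or.inr hq

/-- Near a regular point of `f` the alternative between vanishing identically and being nonzero on a
dense set has the same outcome at all points. -/
theorem IsRegularAt.eventually_iff (h : IsRegularAt f p) :
    ∀ᶠ q in 𝓝 p, ((∀ᶠ w in 𝓝 q, f w = 0) ↔ ∀ᶠ w in 𝓝 p, f w = 0) := by
  rcases h with h | h
  · filter_upwards [h.eventually_nhds] with q hq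
    exact iff_of_true hq h
  · have hne : ∀ q, q ∈ closure {w | f w ≠ 0} → ¬ ∀ᶠ w in 𝓝 q, f w = 0 := fun q hq h0 => by
      obtain ⟨w, hw, hw'⟩ := (mem_closure_iff_frequently.1 hq).and_eventually h0 |>.exists
      exact hw hw'
    filter_upwards [h] with q hq
    exact iff_of_false (hne q hq) (hne p h.self_of_nhds)

theorem IsRegularAt.mem_closure (h : IsRegularAt f p) (h0 : ¬ ∀ᶠ w in 𝓝 p, f w = 0) :
    ∀ᶠ w in 𝓝 p, w ∈ closure {w' | f w' ≠ 0} :=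
  h.resolve_left h0

theorem isOpen_setOf_isRegularAt (f : (Fin n → ℝ) → ℝ) : IsOpen {p | IsRegularAt f p} :=
  isOpen_iff_mem_nhds.2 fun _ h => IsRegularAt.eventually h

theorem dense_setOf_isRegularAt (f : (Fin n → ℝ) → ℝ) : Dense {p | IsRegularAt f p} := by
  intro p
  rw [mem_closure_iff_frequently]
  by_cases hp : ∃ᶠ q in 𝓝 p, ∀ᶠ w in 𝓝 q, f w = 0
  · exact hp.mono fun q hq => Or.inl hq
  · rw [not_frequently] at hp
    refine Eventually.frequently ?_
    filter_upwards [hp.eventually_nhds] with q hq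
    refine Or.inr (hq.mono fun w hw => ?_)
    exact mem_closure_iff_frequently.2 (not_eventually.1 hw)

theorem isOpen_setOf_isRegularPoint (Z : Fin n → Fin n → Fin n → (Fin n → ℝ) → ℝ) (i₀ : Fin n) :
    IsOpen {p | IsRegularPoint Z i₀ p} := by
  refine isOpen_iff_mem_nhds.2 fun p hp => ?_
  have key : ∀ᶠ q in 𝓝 p, ∀ j k, j ≠ i₀ → k ≠ i₀ → j ≠ k →
      IsRegularAt (Z i₀ i₀ j) q ∧
        ((∀ᶠ w in 𝓝 q, Z i₀ i₀ j w = 0) → ¬ (∀ᶠ w in 𝓝 q, Z i₀ i₀ k w = 0) →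
          IsRegularAt (Z k k j) q) := by
    simp only [eventually_all]
    intro j k hj hk hjk
    obtain ⟨hr, himp⟩ := hp j k hj hk hjk
    have hrk := (hp k j hk hj hjk.symm).1
    by_cases h : (∀ᶠ w in 𝓝 p, Z i₀ i₀ j w = 0) ∧ ¬ ∀ᶠ w in 𝓝 p, Z i₀ i₀ k w = 0
    · filter_upwards [hr.eventually, (himp h.1 h.2).eventually] with q h1 h2
      exact ⟨h1, fun _ _ => h2⟩
    · filter_upwards [hr.eventually, hr.eventually_iff, hrk.eventually_iff] with q h1 h2 h3
      refine ⟨h1, fun h4 h5 => absurd ⟨h2.1 h4, fun h6 => h5 (h3.2 h6)⟩ h⟩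
  exact key

theorem dense_setOf_isRegularPoint (Z : Fin n → Fin n → Fin n → (Fin n → ℝ) → ℝ) (i₀ : Fin n) :
    Dense {p | IsRegularPoint Z i₀ p} := by
  have h : Dense (⋂ s : Fin n × Fin n, {p | IsRegularAt (Z s.1 s.1 s.2) p}) :=
    dense_iInter_of_isOpen (fun _ => isOpen_setOf_isRegularAt _)
      fun _ => dense_setOf_isRegularAt _
  refine h.mono fun p hp j k _ _ _ => ?_
  rw [Set.mem_iInter] at hp
  exact ⟨hp (i₀, j), fun _ _ => hp (k, j)⟩

end Regular

/-! ### The distinguished index -/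

section Rank

/-- The `2 × 2` minors of a matrix of rank at most one vanish. -/
theorem mul_eq_mul_of_rank_le_one {A : Matrix (Fin 3) (Fin 3) ℝ} (hA : A.rank ≤ 1)
    (s t c d : Fin 3) : A s c * A t d = A s d * A t c := by
  have h : (A.submatrix ![s, t] ![c, d]).det = 0 := by
    by_contra hne
    have h1 := Matrix.rank_of_isUnit _
      ((Matrix.isUnit_iff_isUnit_det _).2 (isUnit_iff_ne_zero.2 hne))
    have h2 := Matrix.rank_submatrix_le A ![s, t] ![c, d]
    rw [h1, Fintype.card_fin] at h2
    omega
  rw [Matrix.det_fin_two] at h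
  simp only [Matrix.submatrix_apply, Matrix.cons_val_zero, Matrix.cons_val_one] at h
  linarith

/-- If the algebraic part has rank one at `w`, exactly one of the three coefficients `Z_{ij}^k` with
distinct indices is nonzero at `w`. -/
theorem exists_unique_ne_zero_of_rank_eq_one {Z : Fin 3 → Fin 3 → Fin 3 → (Fin 3 → ℝ) → ℝ}
    {w : Fin 3 → ℝ} (hZ : ∀ i j k, Z i j k w = Z j i k w)
    (hrank : (algebraicMatrix Z w).rank = 1) :
    ∃ i₀, ∀ i j k, i ≠ j → j ≠ k → i ≠ k → (Z i j k w ≠ 0 ↔ k = i₀) := by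
  have hab := mul_eq_mul_of_rank_le_one hrank.le 0 1 0 1
  have hac := mul_eq_mul_of_rank_le_one hrank.le 0 1 0 2
  have hbc := mul_eq_mul_of_rank_le_one hrank.le 0 2 1 2
  simp [algebraicMatrix] at hab hac hbc
  have hne : ¬ (Z 1 2 0 w = 0 ∧ Z 0 2 1 w = 0 ∧ Z 0 1 2 w = 0) := by
    rintro ⟨h0, h1, h2⟩
    have : algebraicMatrix Z w = 0 := by
      ext s t
      fin_cases s <;> fin_cases t <;>
        simp [algebraicMatrix, h0, h1, h2, hZ 2 1 0, hZ 2 0 1, hZ 1 0 2]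
    rw [this, Matrix.rank_zero] at hrank
    exact zero_ne_one hrank
  have h3 : ∀ i₀, (∀ k, (Z (k + 1) (k + 2) k w ≠ 0 ↔ k = i₀)) →
      ∃ i₀, ∀ i j k, i ≠ j → j ≠ k → i ≠ k → (Z i j k w ≠ 0 ↔ k = i₀) := by
    refine fun i₀ h => ⟨i₀, fun i j k hij hjk hik => ?_⟩
    have hcases : (i = k + 1 ∧ j = k + 2) ∨ (i = k + 2 ∧ j = k + 1) := by omega
    rcases hcases with ⟨rfl, rfl⟩ | ⟨rfl, rfl⟩
    · exact h k
    · rw [hZ]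
      exact h k
  have e1 := hZ 2 0 1
  have e2 := hZ 2 1 0
  have e3 := hZ 1 0 2
  by_cases h0 : Z 1 2 0 w = 0
  · by_cases h1 : Z 0 2 1 w = 0
    · refine h3 2 fun k => ?_
      fin_cases k <;> simp_all
    · refine h3 1 fun k => ?_
      fin_cases k <;> simp_all
  · refine h3 0 fun k => ?_
    fin_cases k <;> simp_all

theorem IsRiemannCoordinates.exists_distinguishedIndex {m : ℕ∞}
    {R : Fin 3 → (Fin 3 → ℝ) → (Fin 3 → ℝ)}
    {ρ : OpenPartialHomeomorph (Fin 3 → ℝ) (Fin 3 → ℝ)}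
    (hρ : IsRiemannCoordinates (m + 1) R ρ) (hm : 1 ≤ m) (hconn : IsConnected ρ.source)
    (hrank : ∀ w ∈ ρ.target, (algebraicMatrix (riemannCoeff R ρ) w).rank = 1) :
    ∃ i₀ : Fin 3, ∀ i j k, i ≠ j → j ≠ k → i ≠ k → ∀ w ∈ ρ.target,
      (riemannCoeff R ρ i j k w ≠ 0 ↔ k = i₀) := by
  have htarget : IsConnected ρ.target := by
    rw [← ρ.image_source_eq_target]
    exact hconn.image _ ρ.continuousOn
  have huniq := fun w hw =>
    exists_unique_ne_zero_of_rank_eq_one (hρ.riemannCoeff_symm hm hw) (hrank w hw)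
  choose! c hc using huniq
  have hopen : ∀ i₀ : Fin 3, IsOpen {w ∈ ρ.target | c w = i₀} := by
    intro i₀
    have hcont : ContinuousOn (riemannCoeff R ρ (i₀ + 1) (i₀ + 2) i₀) ρ.target :=
      (hρ.contDiffOn_riemannCoeff (r := 0) (by simpa using hm) _ _ _).continuousOn
    convert hcont.isOpen_inter_preimage ρ.open_target isOpen_compl_singleton using 1
    ext w
    refine and_congr_right fun hw => ?_
    have := hc w hw (i₀ + 1) (i₀ + 2) i₀ (by omega) (by omega) (by omega)
    simpa [eq_comm] using this.symm
  obtain ⟨w₀, hw₀⟩ := htarget.nonempty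
  have hsub : ρ.target ⊆ {w ∈ ρ.target | c w = c w₀} := by
    refine IsPreconnected.subset_left_of_subset_union (hopen _)
      (v := ⋃ i : {i : Fin 3 // i ≠ c w₀}, {w ∈ ρ.target | c w = i})
      (isOpen_iUnion fun i => hopen _) ?_ ?_ ⟨w₀, hw₀, hw₀, rfl⟩ htarget.isPreconnected
    · rw [Set.disjoint_left]
      rintro w ⟨-, hw⟩ hw'
      obtain ⟨i, -, hi⟩ := Set.mem_iUnion.1 hw'
      exact i.2 (hi.symm.trans hw)
    · intro w hw
      by_cases h : c w = c w₀
      · exact Or.inl ⟨hw, h⟩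
      · exact Or.inr (Set.mem_iUnion.2 ⟨⟨c w, h⟩, hw, rfl⟩)
  refine ⟨c w₀, fun i j k hij hjk hik w hw => ?_⟩
  rw [← (hsub hw).2]
  exact hc w hw i j k hij hjk hik

end Rank

/-! ### Degeneracy of solutions and extensions -/

section Degenerate

variable {m r : ℕ∞} {R : Fin 3 → (Fin 3 → ℝ) → (Fin 3 → ℝ)}
  {ρ : OpenPartialHomeomorph (Fin 3 → ℝ) (Fin 3 → ℝ)} {i₀ : Fin 3}

theorem exists_other_indices (i₀ : Fin 3) : ∃ j k : Fin 3, i₀ ≠ j ∧ i₀ ≠ k ∧ j ≠ k :=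
  ⟨i₀ + 1, i₀ + 2, by omega, by omega, by omega⟩

theorem IsBetaSolution.eq_zero {Z : Fin 3 → Fin 3 → Fin 3 → (Fin 3 → ℝ) → ℝ}
    {V W : Set (Fin 3 → ℝ)} (hVW : V ⊆ W)
    (hi₀ : ∀ i j k, i ≠ j → j ≠ k → i ≠ k → ∀ w ∈ W, (Z i j k w ≠ 0 ↔ k = i₀))
    {γ : Fin 3 → (Fin 3 → ℝ) → ℝ} (hγ : IsBetaSolution Z r V γ) :
    ∀ w ∈ V, γ i₀ w = 0 := by
  intro w hw
  obtain ⟨l, k, hl, hk, hlk⟩ := exists_other_indices i₀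
  have h1 : Z i₀ k l w = 0 := by
    by_contra h
    exact hl ((hi₀ i₀ k l hk hlk.symm hl w (hVW hw)).1 h).symm
  have h2 : Z l k i₀ w ≠ 0 := (hi₀ l k i₀ hlk hk.symm hl.symm w (hVW hw)).2 rfl
  have h3 : Z l k i₀ w * γ i₀ w = 0 := by
    rcases lt_or_gt_of_ne hl with h | h
    · rw [← hγ.algebraic i₀ l k h hk.symm hlk.symm w hw, h1, zero_mul]
    · rw [hγ.algebraic l i₀ k h hlk.symm hk.symm w hw, h1, zero_mul]
  exact (mul_eq_zero.1 h3).resolve_left h2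

/-- Differentiation of `(D²η)(∂_i, ∂_j) = 0` along `∂_k`. -/
theorem IsRiemannCoordinates.third_derivative_eq (hρ : IsRiemannCoordinates (m + 1) R ρ)
    (hm : 1 ≤ m) {U : Set (Fin 3 → ℝ)} (hU : U ⊆ ρ.source) (hUo : IsOpen U)
    {η : (Fin 3 → ℝ) → ℝ} (hη : ContDiffOn ℝ 3 η U)
    (horth : ∀ i j, i ≠ j → ∀ u ∈ U,
      fderiv ℝ (fderiv ℝ η) u (normalizedFrame R ρ i u) (normalizedFrame R ρ j u) = 0)
    {u : Fin 3 → ℝ} (hu : u ∈ U) {i j : Fin 3} (k : Fin 3) (hij : i ≠ j) :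
    fderiv ℝ (fderiv ℝ (fderiv ℝ η)) u (normalizedFrame R ρ k u) (normalizedFrame R ρ i u)
        (normalizedFrame R ρ j u) +
      riemannCoeff R ρ k i j (ρ u) *
        fderiv ℝ (fderiv ℝ η) u (normalizedFrame R ρ j u) (normalizedFrame R ρ j u) +
      riemannCoeff R ρ k j i (ρ u) *
        fderiv ℝ (fderiv ℝ η) u (normalizedFrame R ρ i u) (normalizedFrame R ρ i u) = 0 := by
  have hus := hU hu
  have hw := ρ.map_source hus
  have hH : DifferentiableAt ℝ (fderiv ℝ (fderiv ℝ η)) u :=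
    (((hη.fderiv_of_isOpen (m := 2) hUo (by norm_num)).fderiv_of_isOpen (m := 1) hUo
      (by norm_num)).differentiableOn (by norm_num)).differentiableAt (hUo.mem_nhds hu)
  have hN := hρ.hasFDerivAt_normalizedFrame hm hus
  have h1 := (hH.hasFDerivAt.clm_apply (hN i)).clm_apply (hN j)
  have h2 : HasFDerivAt (fun u => fderiv ℝ (fderiv ℝ η) u (normalizedFrame R ρ i u)
      (normalizedFrame R ρ j u)) (0 : (Fin 3 → ℝ) →L[ℝ] ℝ) u :=
    (hasFDerivAt_const 0 u).congr_of_eventuallyEq (by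
      filter_upwards [hUo.mem_nhds hu] with v hv using horth i j hij v hv)
  have hD : ∀ j, fderiv ℝ (coordField ρ j) (ρ u) (Pi.single k 1) =
      ∑ q, riemannCoeff R ρ k j q (ρ u) • normalizedFrame R ρ q u := by
    intro j
    rw [hρ.fderiv_coordField hm hw k j]
    refine Finset.sum_congr rfl fun q _ => ?_
    rw [← hρ.normalizedFrame_symm hw, ρ.left_inv hus]
  have h3 := congrArg (fun L => L (normalizedFrame R ρ k u)) (h1.unique h2)
  simp only [add_apply, ContinuousLinearMap.comp_apply, ContinuousLinearMap.flip_apply,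
    hρ.fderiv_normalizedFrame hus, hD, map_sum, map_smul, sum_apply, smul_apply, smul_eq_mul,
    zero_apply] at h3
  rw [Finset.sum_eq_single i (fun q _ hq => by rw [horth i q hq.symm u hu, mul_zero]) (by simp),
    Finset.sum_eq_single j (fun q _ hq => by rw [horth q j hq u hu, mul_zero]) (by simp)] at h3
  linarith

theorem IsRiemannCoordinates.hessian_eq_zero (hρ : IsRiemannCoordinates (m + 1) R ρ)
    (hm : 1 ≤ m)
    (hi₀ : ∀ i j k, i ≠ j → j ≠ k → i ≠ k → ∀ w ∈ ρ.target,
      (riemannCoeff R ρ i j k w ≠ 0 ↔ k = i₀))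
    {U : Set (Fin 3 → ℝ)} (hU : U ⊆ ρ.source) (hUo : IsOpen U) {η : (Fin 3 → ℝ) → ℝ}
    (hη : ContDiffOn ℝ 3 η U) (horth : IsOrthogonalForHessian R η U) :
    ∀ u ∈ U, fderiv ℝ (fderiv ℝ η) u (R i₀ u) (R i₀ u) = 0 := by
  intro u hu
  obtain ⟨j, k, hj, hk, hjk⟩ := exists_other_indices i₀
  have hw := ρ.map_source (hU hu)
  have horth' : ∀ i j, i ≠ j → ∀ u ∈ U,
      fderiv ℝ (fderiv ℝ η) u (normalizedFrame R ρ i u) (normalizedFrame R ρ j u) = 0 := by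
    intro i j hij u hu
    simp [normalizedFrame, horth i j hij u hu]
  have hz : ∀ i j l, i ≠ j → j ≠ l → i ≠ l → l ≠ i₀ → riemannCoeff R ρ i j l (ρ u) = 0 := by
    intro i j l hij hjl hil hl
    by_contra h
    exact hl ((hi₀ i j l hij hjl hil _ hw).1 h)
  have h1 := hρ.third_derivative_eq hm hU hUo hη horth' hu j hk
  have h2 := hρ.third_derivative_eq hm hU hUo hη horth' hu i₀ hjk
  have hsymm : IsSymmSndFDerivAt ℝ (fderiv ℝ η) u := by
    refine ContDiffAt.isSymmSndFDerivAt (n := 2) ?_ (by simp)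
    exact (hη.fderiv_of_isOpen hUo (by norm_num)).contDiffAt (hUo.mem_nhds hu)
  rw [hz j i₀ k hj.symm hk hjk hk.symm, hsymm.eq] at h1
  rw [hz i₀ j k hj hjk hk hk.symm, hz i₀ k j hk hjk.symm hj hj.symm] at h2
  have h3 : riemannCoeff R ρ j k i₀ (ρ u) ≠ 0 := (hi₀ j k i₀ hjk hk.symm hj.symm _ hw).2 rfl
  have h4 : fderiv ℝ (fderiv ℝ η) u (normalizedFrame R ρ i₀ u) (normalizedFrame R ρ i₀ u) = 0 := by
    refine (mul_eq_zero.1 (?_ : riemannCoeff R ρ j k i₀ (ρ u) * _ = 0)).resolve_left h3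
    linarith
  simpa [normalizedFrame, hρ.diag i₀ u (hU hu)] using h4

end Degenerate

/-! ### Local solvability of the β-system at regular points -/

theorem IsDarbouxSolution.sub {n : ℕ} {a j k : Fin n} {A B C D E G u v u' v' : (Fin n → ℝ) → ℝ}
    {V : Set (Fin n → ℝ)} (h : IsDarbouxSolution a j k A B C D E G V u v)
    (h' : IsDarbouxSolution a j k A B C D E G V u' v') :
    IsDarbouxSolution a j k A B C D E G V (fun w => u w - u' w) (fun w => v w - v' w) where
  fst_a w hw := by convert! (h.fst_a w hw).sub (h'.fst_a w hw) using 1; ring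
  snd_a w hw := by convert! (h.snd_a w hw).sub (h'.snd_a w hw) using 1; ring
  fst_k w hw := by convert! (h.fst_k w hw).sub (h'.fst_k w hw) using 1; ring
  snd_j w hw := by convert! (h.snd_j w hw).sub (h'.snd_j w hw) using 1; ring

/-- If `f` is nonzero on a dense subset of the open set `V`, a continuous function `g` on `V` with
`f * g = 0` vanishes. -/
theorem eq_zero_of_mul_eq_zero_of_mem_closure {n : ℕ} {f g : (Fin n → ℝ) → ℝ}
    {V : Set (Fin n → ℝ)} (hV : IsOpen V) (hf : ∀ w ∈ V, w ∈ closure {w' | f w' ≠ 0})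
    (hg : ContinuousOn g V) (h : ∀ w ∈ V, f w * g w = 0) : ∀ w ∈ V, g w = 0 := by
  intro w hw
  by_contra hne
  have hnear : ∀ᶠ v in 𝓝 w, v ∈ V ∧ g v ≠ 0 :=
    (hV.eventually_mem hw).and
      ((hg.continuousAt (hV.mem_nhds hw)).eventually_ne hne)
  obtain ⟨v, hv, hvV, hgv⟩ :=
    ((mem_closure_iff_frequently.1 (hf w hw)).and_eventually hnear).exists
  exact (mul_ne_zero hv hgv) (h v hvV)

section Free

variable {n : ℕ} {Z : Fin n → Fin n → Fin n → (Fin n → ℝ) → ℝ} {r : ℕ∞} {W : Set (Fin n → ℝ)}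
  {p : Fin n → ℝ} {S T : Finset (Fin n)}

theorem SolutionsFreeIn.subset (hS : SolutionsFreeIn Z r W S p) (hT : SolutionsFreeIn Z r W T p) :
    S ⊆ T := by
  intro i hi
  by_contra hiT
  obtain ⟨δ, hδ, -, h⟩ := hS
  obtain ⟨δ', hδ', -, h'⟩ := hT
  have hmin : 0 < min δ δ' := lt_min hδ hδ'
  obtain ⟨γ, hγ, hγ1⟩ := (h _ hmin (min_le_left _ _)).2.1 (fun _ _ => 1)
    fun _ _ => contDiffOn_const
  have h1 := hγ1 i hi (p i) (Metric.mem_ball_self hmin)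
  have h0 := (h' _ hmin (min_le_right _ _)).1 γ hγ i hiT p (Metric.mem_ball_self hmin)
  rw [Function.update_eq_self, h0] at h1
  exact zero_ne_one h1

/-- The set of components that carry the free functions is determined by the system. -/
theorem SolutionsFreeIn.eq (hS : SolutionsFreeIn Z r W S p) (hT : SolutionsFreeIn Z r W T p) :
    S = T :=
  (hS.subset hT).antisymm (hT.subset hS)

theorem isBetaSolution_zero (Z : Fin n → Fin n → Fin n → (Fin n → ℝ) → ℝ) (r : ℕ∞)
    (V : Set (Fin n → ℝ)) : IsBetaSolution Z r V fun _ _ => 0 where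
  contDiffOn _ := contDiffOn_const
  differential _ _ _ _ _ := by simp
  algebraic _ _ _ _ _ _ _ _ := by simp

theorem solutionsFreeIn_empty (h : ∃ δ₀ > 0, Metric.ball p δ₀ ⊆ W ∧ ∀ δ, 0 < δ → δ ≤ δ₀ →
    ∀ γ, IsBetaSolution Z r (Metric.ball p δ) γ → ∀ i, ∀ w ∈ Metric.ball p δ, γ i w = 0) :
    SolutionsFreeIn Z r W ∅ p := by
  obtain ⟨δ₀, hδ₀, hW, h⟩ := h
  refine ⟨δ₀, hδ₀, hW, fun δ hδ hδδ₀ => ⟨fun γ hγ i _ => h δ hδ hδδ₀ γ hγ i, fun φ _ =>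
    ⟨_, isBetaSolution_zero Z r _, by simp⟩, fun γ γ' hγ hγ' _ i w hw => ?_⟩⟩
  rw [h δ hδ hδδ₀ γ hγ i w hw, h δ hδ hδδ₀ γ' hγ' i w hw]

end Free

/-- The properties of the coefficients `Z_{ij}^k` on which the local analysis of the β-system rests:
they are of class `C^r`, symmetric in the lower indices, satisfy the equations of a flat connection,
and among those with distinct indices exactly the ones with upper index `i₀` are nonzero. -/
structure IsRankOneConnection (Z : Fin 3 → Fin 3 → Fin 3 → (Fin 3 → ℝ) → ℝ) (r : ℕ∞)
    (W : Set (Fin 3 → ℝ)) (i₀ : Fin 3) : Prop where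
  isOpen : IsOpen W
  contDiffOn : ∀ i j k, ContDiffOn ℝ r (Z i j k) W
  symm : ∀ i j k, ∀ w ∈ W, Z i j k w = Z j i k w
  flat : ∀ l i j q, ∀ w ∈ W,
    fderiv ℝ (Z i j q) w (Pi.single l 1) + ∑ k, Z i j k w * Z l k q w =
      fderiv ℝ (Z l j q) w (Pi.single i 1) + ∑ k, Z l j k w * Z i k q w
  ne_zero_iff : ∀ i j k, i ≠ j → j ≠ k → i ≠ k → ∀ w ∈ W, (Z i j k w ≠ 0 ↔ k = i₀)

theorem sum_three {a j k : Fin 3} (haj : a ≠ j) (hak : a ≠ k) (hjk : j ≠ k) (f : Fin 3 → ℝ) :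
    ∑ i, f i = f a + f j + f k := by
  have h : (Finset.univ : Finset (Fin 3)) = {a, j, k} := by
    ext i
    simp only [Finset.mem_univ, Finset.mem_insert, Finset.mem_singleton, true_iff]
    omega
  rw [h, Finset.sum_insert (by simp [haj, hak]), Finset.sum_pair hjk, add_assoc]

/-- The triple with the components `u` and `v` at the indices `j` and `k`, and zero elsewhere. -/
def triple (j k : Fin 3) (u v : (Fin 3 → ℝ) → ℝ) (i : Fin 3) (w : Fin 3 → ℝ) : ℝ :=
  if i = j then u w else if i = k then v w else 0

theorem triple_fst (j k : Fin 3) (u v : (Fin 3 → ℝ) → ℝ) : triple j k u v j = u := by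
  funext w
  simp [triple]

theorem triple_snd {j k : Fin 3} (hjk : j ≠ k) (u v : (Fin 3 → ℝ) → ℝ) : triple j k u v k = v := by
  funext w
  simp [triple, hjk.symm]

theorem triple_other {a j k : Fin 3} (haj : a ≠ j) (hak : a ≠ k) (u v : (Fin 3 → ℝ) → ℝ) :
    triple j k u v a = fun _ => 0 := by
  funext w
  simp [triple, haj, hak]

namespace IsRankOneConnection

variable {Z : Fin 3 → Fin 3 → Fin 3 → (Fin 3 → ℝ) → ℝ} {r : ℕ∞} {V W : Set (Fin 3 → ℝ)}
  {a j k : Fin 3} {p w : Fin 3 → ℝ} {γ : Fin 3 → (Fin 3 → ℝ) → ℝ}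

theorem eq_zero (hZ : IsRankOneConnection Z r W a) (haj : a ≠ j) (hak : a ≠ k) (hjk : j ≠ k)
    (hw : w ∈ W) : Z a j k w = 0 := by
  by_contra h
  exact hak ((hZ.ne_zero_iff a j k haj hjk hak w hw).1 h).symm

theorem compat_log (hZ : IsRankOneConnection Z r W a) (haj : a ≠ j) (hak : a ≠ k) (hjk : j ≠ k)
    (hw : w ∈ W) (h : Z a a j w = 0) :
    fderiv ℝ (Z a j j) w (Pi.single k 1) = fderiv ℝ (Z k j j) w (Pi.single a 1) := by
  have h1 := hZ.flat k a j j w hw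
  rw [sum_three haj hak hjk, sum_three haj hak hjk, hZ.symm k a j w hw,
    hZ.eq_zero haj hak hjk hw, hZ.eq_zero hak haj hjk.symm hw, h] at h1
  linarith

theorem compat_coupling (hZ : IsRankOneConnection Z r W a) (haj : a ≠ j) (hak : a ≠ k)
    (hjk : j ≠ k) (hw : w ∈ W) (h : Z a a k w = 0) :
    fderiv ℝ (Z j j k) w (Pi.single a 1) = (Z a j j w - Z a k k w) * Z j j k w := by
  have h1 := hZ.flat a j j k w hw
  have h2 : fderiv ℝ (Z a j k) w = 0 := by
    have : Z a j k =ᶠ[𝓝 w] fun _ => 0 := by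
      filter_upwards [hZ.isOpen.mem_nhds hw] with v hv using hZ.eq_zero haj hak hjk hv
    rw [this.fderiv_eq, fderiv_fun_const]
    rfl
  rw [sum_three haj hak hjk, sum_three haj hak hjk, hZ.symm j a k w hw,
    hZ.eq_zero haj hak hjk hw, h, h2, zero_apply] at h1
  linarith

theorem differentiableAt_of_solution (hr : 1 ≤ r) (hV : IsOpen V) (hγ : IsBetaSolution Z r V γ)
    (hw : w ∈ V) (i : Fin 3) : DifferentiableAt ℝ (γ i) w :=
  ((hγ.contDiffOn i).differentiableOn
    (by exact_mod_cast (zero_lt_one.trans_le hr).ne')).differentiableAt (hV.mem_nhds hw)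

/-- If the component `γ^k` of a solution vanishes, its differential equation in the direction `i`
becomes algebraic. -/
theorem mul_eq_zero_of_solution (hV : IsOpen V) (hγ : IsBetaSolution Z r V γ) {i : Fin 3}
    (hik : i ≠ k) (h0 : ∀ w ∈ V, γ k w = 0) : ∀ w ∈ V, Z k k i w * γ i w = 0 := by
  intro w hw
  have h1 := hγ.differential i k hik w hw
  have h2 : γ k =ᶠ[𝓝 w] fun _ => 0 := by
    filter_upwards [hV.mem_nhds hw] with v hv using h0 v hv
  rw [h2.fderiv_eq, fderiv_fun_const, h0 w hw] at h1
  simp only [Pi.zero_apply, zero_apply] at h1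
  linarith

theorem darboux_of_beta (hZ : IsRankOneConnection Z r W a) (haj : a ≠ j) (hak : a ≠ k)
    (hjk : j ≠ k) (hr : 1 ≤ r) (hV : IsOpen V) (hVW : V ⊆ W) (hγ : IsBetaSolution Z r V γ) :
    IsDarbouxSolution a j k (Z a j j) (Z a k k) (Z k j j) (Z j j k) (Z j k k) (Z k k j) V
      (γ j) (γ k) := by
  have h0 := hγ.eq_zero hVW hZ.ne_zero_iff
  have hd := fun w hw i => differentiableAt_of_solution hr hV hγ (w := w) hw i
  refine ⟨fun w hw => ?_, fun w hw => ?_, fun w hw => ?_, fun w hw => ?_⟩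
  · have := (hd w hw j).hasPartialAt a
    rwa [hγ.differential a j haj w hw, h0 w hw, mul_zero, sub_zero,
      hZ.symm j a j w (hVW hw)] at this
  · have := (hd w hw k).hasPartialAt a
    rwa [hγ.differential a k hak w hw, h0 w hw, mul_zero, sub_zero,
      hZ.symm k a k w (hVW hw)] at this
  · have := (hd w hw j).hasPartialAt k
    rwa [hγ.differential k j hjk.symm w hw, hZ.symm j k j w (hVW hw)] at this
  · have := (hd w hw k).hasPartialAt j
    rwa [hγ.differential j k hjk w hw, hZ.symm k j k w (hVW hw)] at this

theorem beta_of_darboux (hZ : IsRankOneConnection Z r W a) (haj : a ≠ j) (hak : a ≠ k)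
    (hjk : j ≠ k) (hr : 1 ≤ r) (hV : IsOpen V) (hVW : V ⊆ W) {u v : (Fin 3 → ℝ) → ℝ}
    (hu : ContDiffOn ℝ r u V) (hv : ContDiffOn ℝ r v V)
    (hsol : IsDarbouxSolution a j k (Z a j j) (Z a k k) (Z k j j) (Z j j k) (Z j k k) (Z k k j) V
      u v)
    (huj : ∀ w ∈ V, Z a a j w * u w = 0) (hvk : ∀ w ∈ V, Z a a k w * v w = 0) :
    IsBetaSolution Z r V (triple j k u v) := by
  have hcases : ∀ i : Fin 3, i = a ∨ i = j ∨ i = k := by omega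
  have ej := triple_fst j k u v
  have ek := triple_snd hjk u v
  have ea := triple_other haj hak u v
  have hd : ∀ {f : (Fin 3 → ℝ) → ℝ}, ContDiffOn ℝ r f V → ∀ w ∈ V, DifferentiableAt ℝ f w :=
    fun hf w hw => (hf.differentiableOn
      (by exact_mod_cast (zero_lt_one.trans_le hr).ne')).differentiableAt (hV.mem_nhds hw)
  refine ⟨fun i => ?_, fun i l hil w hw => ?_, fun i l q hil hqi hql w hw => ?_⟩
  · rcases hcases i with rfl | rfl | rfl
    · rw [ea]
      exact contDiffOn_const
    · rwa [ej]
    · rwa [ek]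
  · have hW := hVW hw
    rcases hcases l with rfl | rfl | rfl
    · rw [ea, fderiv_fun_const]
      rcases hcases i with rfl | rfl | rfl
      · exact absurd rfl hil
      · rw [ej, huj w hw]
        simp
      · rw [ek, hvk w hw]
        simp
    · rw [ej]
      rcases hcases i with rfl | rfl | rfl
      · rw [ea, (hsol.fst_a w hw).fderiv_eq (hd hu w hw), hZ.symm l i l w hW]
        ring
      · exact absurd rfl hil
      · rw [ek, (hsol.fst_k w hw).fderiv_eq (hd hu w hw), hZ.symm l i l w hW]
    · rw [ek]
      rcases hcases i with rfl | rfl | rfl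
      · rw [ea, (hsol.snd_a w hw).fderiv_eq (hd hv w hw), hZ.symm l i l w hW]
        ring
      · rw [ej, (hsol.snd_j w hw).fderiv_eq (hd hv w hw), hZ.symm l i l w hW]
      · exact absurd rfl hil
  · -- For each factor either the component is `γ^a = 0` or the coefficient has upper index `≠ a`.
    have hprod : ∀ i l q : Fin 3, i ≠ l → q ≠ i → q ≠ l → Z i q l w * triple j k u v l w = 0 := by
      intro i l q hil hqi hql
      rcases eq_or_ne l a with rfl | hla
      · rw [ea, mul_zero]
      · have : Z i q l w = 0 := by
          by_contra h
          exact hla ((hZ.ne_zero_iff i q l hqi.symm hql hil w (hVW hw)).1 h)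
        rw [this, zero_mul]
    rw [hprod i l q hil.ne hqi hql, hprod l i q hil.ne' hql hqi]

theorem exists_ball (hZ : IsRankOneConnection Z r W a) (hp : p ∈ W) {P : (Fin 3 → ℝ) → Prop}
    (hP : ∀ᶠ w in 𝓝 p, P w) : ∃ δ > 0, Metric.ball p δ ⊆ W ∧ ∀ w ∈ Metric.ball p δ, P w := by
  obtain ⟨δ, hδ, h⟩ := Metric.eventually_nhds_iff_ball.1
    ((hZ.isOpen.eventually_mem hp).and hP)
  exact ⟨δ, hδ, fun w hw => (h w hw).1, fun w hw => (h w hw).2⟩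

/-- Both coefficients `Z_{aa}^j`, `Z_{aa}^k` vanish near `p`: two free functions. -/
theorem solutionsFreeIn_erase (hZ : IsRankOneConnection Z r W a) (haj : a ≠ j) (hak : a ≠ k)
    (hjk : j ≠ k) (hr : 1 ≤ r) (hp : p ∈ W) (hzj : ∀ᶠ w in 𝓝 p, Z a a j w = 0)
    (hzk : ∀ᶠ w in 𝓝 p, Z a a k w = 0) : SolutionsFreeIn Z r W (Finset.univ.erase a) p := by
  obtain ⟨δ, hδ, hW, h0⟩ := hZ.exists_ball hp (hzj.and hzk)
  have hcd := fun i j k => (hZ.contDiffOn i j k).mono hW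
  obtain ⟨δ₀, hδ₀, hδ₀δ, hwell⟩ := darboux_wellPosed haj hak hjk hr hδ (hcd a j j) (hcd a k k)
    (hcd k j j) (hcd j j k) (hcd j k k) (hcd k k j)
    (fun w hw => hZ.compat_log haj hak hjk (hW hw) (h0 w hw).1)
    (fun w hw => hZ.compat_log hak haj hjk.symm (hW hw) (h0 w hw).2)
    (fun w hw => hZ.compat_coupling haj hak hjk (hW hw) (h0 w hw).2)
    (fun w hw => hZ.compat_coupling hak haj hjk.symm (hW hw) (h0 w hw).1)
  have hcases : ∀ i : Fin 3, i = a ∨ i = j ∨ i = k := by omega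
  refine ⟨δ₀, hδ₀, (Metric.ball_subset_ball hδ₀δ).trans hW, fun δ' hδ' hδ'₀ => ?_⟩
  have hsub : Metric.ball p δ' ⊆ Metric.ball p δ := Metric.ball_subset_ball (hδ'₀.trans hδ₀δ)
  obtain ⟨hex, huniq⟩ := hwell δ' hδ' hδ'₀
  refine ⟨fun γ hγ i hi => ?_, fun φ hφ => ?_, fun γ γ' hγ hγ' hline => ?_⟩
  · obtain rfl : i = a := by simpa using hi
    exact hγ.eq_zero (hsub.trans hW) hZ.ne_zero_iff
  · obtain ⟨u, v, hu, hv, hsol, huφ, hvφ⟩ := hex (φ j) (φ k) (hφ j (by simp [haj.symm]))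
      (hφ k (by simp [hak.symm]))
    refine ⟨triple j k u v, hZ.beta_of_darboux haj hak hjk hr Metric.isOpen_ball (hsub.trans hW)
      hu hv hsol (fun w hw => by rw [(h0 w (hsub hw)).1, zero_mul])
      (fun w hw => by rw [(h0 w (hsub hw)).2, zero_mul]), fun i hi => ?_⟩
    rcases hcases i with rfl | rfl | rfl
    · simp at hi
    · rw [triple_fst]
      exact huφ
    · rw [triple_snd hjk]
      exact hvφ
  · have hd := hZ.darboux_of_beta haj hak hjk hr Metric.isOpen_ball (hsub.trans hW) hγ
    have hd' := hZ.darboux_of_beta haj hak hjk hr Metric.isOpen_ball (hsub.trans hW) hγ'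
    have h := huniq _ _ ((hγ.contDiffOn j).continuousOn.sub (hγ'.contDiffOn j).continuousOn)
      ((hγ.contDiffOn k).continuousOn.sub (hγ'.contDiffOn k).continuousOn) (hd.sub hd')
      (fun t ht => sub_eq_zero.2 (hline j (by simp [haj.symm]) t ht))
      (fun t ht => sub_eq_zero.2 (hline k (by simp [hak.symm]) t ht))
    intro i w hw
    rcases hcases i with rfl | rfl | rfl
    · rw [hγ.eq_zero (hsub.trans hW) hZ.ne_zero_iff w hw,
        hγ'.eq_zero (hsub.trans hW) hZ.ne_zero_iff w hw]
    · exact sub_eq_zero.1 (h w hw).1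
    · exact sub_eq_zero.1 (h w hw).2

/-- Near `p` the coefficients `Z_{aa}^j` and `Z_{kk}^j` vanish, but `Z_{aa}^k` is nonzero on a dense
set: the component `γ^j` is free and the others vanish. The equations that remain for `γ^j` are a
Darboux system for the pair `(γ^j, 0)` without coupling. -/
theorem solutionsFreeIn_singleton (hZ : IsRankOneConnection Z r W a) (haj : a ≠ j) (hak : a ≠ k)
    (hjk : j ≠ k) (hr : 1 ≤ r) (hp : p ∈ W) (hzj : ∀ᶠ w in 𝓝 p, Z a a j w = 0)
    (hnk : ∀ᶠ w in 𝓝 p, w ∈ closure {w' | Z a a k w' ≠ 0})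
    (hzkk : ∀ᶠ w in 𝓝 p, Z k k j w = 0) : SolutionsFreeIn Z r W {j} p := by
  obtain ⟨δ, hδ, hW, h0⟩ := hZ.exists_ball hp (hzj.and (hnk.and hzkk))
  have hcd := fun i j k => (hZ.contDiffOn i j k).mono hW
  have hconst : ContDiffOn ℝ r (fun _ : Fin 3 → ℝ => (0 : ℝ)) (Metric.ball p δ) :=
    contDiffOn_const
  obtain ⟨δ₀, hδ₀, hδ₀δ, hwell⟩ := darboux_wellPosed haj hak hjk hr hδ (hcd a j j) hconst
    (hcd k j j) hconst hconst hconst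
    (fun w hw => hZ.compat_log haj hak hjk (hW hw) (h0 w hw).1)
    (fun w hw => by simp) (fun w hw => by simp) (fun w hw => by simp)
  have hcases : ∀ i : Fin 3, i = a ∨ i = j ∨ i = k := by omega
  refine ⟨δ₀, hδ₀, (Metric.ball_subset_ball hδ₀δ).trans hW, fun δ' hδ' hδ'₀ => ?_⟩
  have hsub : Metric.ball p δ' ⊆ Metric.ball p δ := Metric.ball_subset_ball (hδ'₀.trans hδ₀δ)
  obtain ⟨hex, huniq⟩ := hwell δ' hδ' hδ'₀
  have hγa : ∀ γ, IsBetaSolution Z r (Metric.ball p δ') γ → ∀ w ∈ Metric.ball p δ', γ a w = 0 :=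
    fun γ hγ => hγ.eq_zero (hsub.trans hW) hZ.ne_zero_iff
  have hγk : ∀ γ, IsBetaSolution Z r (Metric.ball p δ') γ → ∀ w ∈ Metric.ball p δ', γ k w = 0 :=
    fun γ hγ => eq_zero_of_mul_eq_zero_of_mem_closure Metric.isOpen_ball
      (fun w hw => (h0 w (hsub hw)).2.1) (hγ.contDiffOn k).continuousOn
      (mul_eq_zero_of_solution Metric.isOpen_ball hγ hak.symm (hγa γ hγ))
  refine ⟨fun γ hγ i hi => ?_, fun φ hφ => ?_, fun γ γ' hγ hγ' hline => ?_⟩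
  · rcases hcases i with rfl | rfl | rfl
    · exact hγa γ hγ
    · simp at hi
    · exact hγk γ hγ
  · obtain ⟨u, v, hu, -, hsol, huφ, -⟩ := hex (φ j) (fun _ => 0) (hφ j (by simp))
      contDiffOn_const
    have hsol' : IsDarbouxSolution a j k (Z a j j) (Z a k k) (Z k j j) (Z j j k) (Z j k k)
        (Z k k j) (Metric.ball p δ') u (fun _ => 0) := by
      refine ⟨hsol.fst_a, fun w hw => ?_, fun w hw => ?_, fun w hw => ?_⟩
      · simpa using hasPartialAt_const a 0 w
      · simpa using hsol.fst_k w hw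
      · simpa [(h0 w (hsub hw)).2.2] using hasPartialAt_const j 0 w
    refine ⟨triple j k u fun _ => 0, hZ.beta_of_darboux haj hak hjk hr Metric.isOpen_ball
      (hsub.trans hW) hu contDiffOn_const hsol'
      (fun w hw => by rw [(h0 w (hsub hw)).1, zero_mul]) (fun w hw => mul_zero _),
      fun i hi => ?_⟩
    obtain rfl := Finset.mem_singleton.1 hi
    rw [triple_fst]
    exact huφ
  · have hd : ∀ γ, IsBetaSolution Z r (Metric.ball p δ') γ → IsDarbouxSolution a j k (Z a j j)
        (fun _ => 0) (Z k j j) (fun _ => 0) (fun _ => 0) (fun _ => 0) (Metric.ball p δ') (γ j)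
        (fun _ => 0) := by
      intro γ hγ
      have h1 := hZ.darboux_of_beta haj hak hjk hr Metric.isOpen_ball (hsub.trans hW) hγ
      refine ⟨h1.fst_a, fun w hw => ?_, fun w hw => ?_, fun w hw => ?_⟩
      · simpa using hasPartialAt_const a 0 w
      · simpa [hγk γ hγ w hw] using h1.fst_k w hw
      · simpa using hasPartialAt_const j 0 w
    have h := huniq _ _ ((hγ.contDiffOn j).continuousOn.sub (hγ'.contDiffOn j).continuousOn)
      (continuousOn_const.sub continuousOn_const) ((hd γ hγ).sub (hd γ' hγ'))
      (fun t ht => sub_eq_zero.2 (hline j (by simp) t ht))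
      (fun t ht => sub_self _)
    intro i w hw
    rcases hcases i with rfl | rfl | rfl
    · rw [hγa γ hγ w hw, hγa γ' hγ' w hw]
    · exact sub_eq_zero.1 (h w hw).1
    · rw [hγk γ hγ w hw, hγk γ' hγ' w hw]

theorem solutionsFreeIn_empty_of_dense (hZ : IsRankOneConnection Z r W a) (haj : a ≠ j)
    (hak : a ≠ k) (hjk : j ≠ k) (hp : p ∈ W)
    (hnk : ∀ᶠ w in 𝓝 p, w ∈ closure {w' | Z a a k w' ≠ 0})
    (hnj : (∀ᶠ w in 𝓝 p, w ∈ closure {w' | Z a a j w' ≠ 0}) ∨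
      ∀ᶠ w in 𝓝 p, w ∈ closure {w' | Z k k j w' ≠ 0}) :
    SolutionsFreeIn Z r W ∅ p := by
  have hcases : ∀ i : Fin 3, i = a ∨ i = j ∨ i = k := by omega
  obtain ⟨l, hl, hnl⟩ : ∃ l, (l = a ∨ l = k) ∧
      ∀ᶠ w in 𝓝 p, w ∈ closure {w' | Z l l j w' ≠ 0} := by
    rcases hnj with h | h
    · exact ⟨a, Or.inl rfl, h⟩
    · exact ⟨k, Or.inr rfl, h⟩
  obtain ⟨δ₀, hδ₀, hW, h0⟩ := hZ.exists_ball hp (hnk.and hnl)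
  refine solutionsFreeIn_empty ⟨δ₀, hδ₀, hW, fun δ hδ hδδ₀ γ hγ => ?_⟩
  have hsub : Metric.ball p δ ⊆ Metric.ball p δ₀ := Metric.ball_subset_ball hδδ₀
  have hγa := hγ.eq_zero (hsub.trans hW) hZ.ne_zero_iff
  have hγk : ∀ w ∈ Metric.ball p δ, γ k w = 0 :=
    eq_zero_of_mul_eq_zero_of_mem_closure Metric.isOpen_ball (fun w hw => (h0 w (hsub hw)).1)
      (hγ.contDiffOn k).continuousOn
      (mul_eq_zero_of_solution Metric.isOpen_ball hγ hak.symm hγa)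
  have hγj : ∀ w ∈ Metric.ball p δ, γ j w = 0 := by
    refine eq_zero_of_mul_eq_zero_of_mem_closure Metric.isOpen_ball (fun w hw => (h0 w (hsub hw)).2)
      (hγ.contDiffOn j).continuousOn ?_
    rcases hl with rfl | rfl
    · exact mul_eq_zero_of_solution Metric.isOpen_ball hγ haj.symm hγa
    · exact mul_eq_zero_of_solution Metric.isOpen_ball hγ hjk hγk
  intro i
  rcases hcases i with rfl | rfl | rfl
  exacts [hγa, hγj, hγk]

/-- Classification of the local solution sets at the regular points. -/
theorem exists_solutionsFreeIn (hZ : IsRankOneConnection Z r W a) (hr : 1 ≤ r) (hp : p ∈ W)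
    (hreg : IsRegularPoint Z a p) :
    SolutionsFreeIn Z r W ∅ p ∨ (∃ l, l ≠ a ∧ SolutionsFreeIn Z r W {l} p) ∨
      SolutionsFreeIn Z r W (Finset.univ.erase a) p := by
  have hmixed : ∀ j k, a ≠ j → a ≠ k → j ≠ k → (∀ᶠ w in 𝓝 p, Z a a j w = 0) →
      ¬ (∀ᶠ w in 𝓝 p, Z a a k w = 0) →
      SolutionsFreeIn Z r W ∅ p ∨ SolutionsFreeIn Z r W {j} p := by
    intro j k haj hak hjk hj hk
    have hnk := (hreg k j hak.symm haj.symm hjk.symm).1.mem_closure hk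
    rcases (hreg j k haj.symm hak.symm hjk).2 hj hk with h | h
    · exact Or.inr (hZ.solutionsFreeIn_singleton haj hak hjk hr hp hj hnk h)
    · exact Or.inl (hZ.solutionsFreeIn_empty_of_dense haj hak hjk hp hnk (Or.inr h))
  obtain ⟨j, k, haj, hak, hjk⟩ := exists_other_indices a
  by_cases hj : ∀ᶠ w in 𝓝 p, Z a a j w = 0 <;> by_cases hk : ∀ᶠ w in 𝓝 p, Z a a k w = 0
  · exact Or.inr (Or.inr (hZ.solutionsFreeIn_erase haj hak hjk hr hp hj hk))
  · rcases hmixed j k haj hak hjk hj hk with h | h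
    · exact Or.inl h
    · exact Or.inr (Or.inl ⟨j, haj.symm, h⟩)
  · rcases hmixed k j hak haj hjk.symm hk hj with h | h
    · exact Or.inl h
    · exact Or.inr (Or.inl ⟨k, hak.symm, h⟩)
  · exact Or.inl (hZ.solutionsFreeIn_empty_of_dense haj hak hjk hp
      ((hreg k j hak.symm haj.symm hjk.symm).1.mem_closure hk)
      (Or.inl ((hreg j k haj.symm hak.symm hjk).1.mem_closure hj)))

end IsRankOneConnection

end RichFrame

end

theorem theorem4p2
    (m r : ℕ∞) (hr : 1 ≤ r) (hrm : r + 1 ≤ m)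
    (Ω : Set (Fin 3 → ℝ)) (hΩ : IsOpen Ω)
    (R : Fin 3 → (Fin 3 → ℝ) → (Fin 3 → ℝ))
    (hR : RichFrame.IsFrame m R Ω) (hrich : RichFrame.IsRich R Ω)
    (ρ : OpenPartialHomeomorph (Fin 3 → ℝ) (Fin 3 → ℝ))
    (hρΩ : ρ.source ⊆ Ω) (hconn : IsConnected ρ.source)
    (hρ : RichFrame.IsRiemannCoordinates (m + 1) R ρ)
    (hrank : ∀ w ∈ ρ.target,
      (RichFrame.algebraicMatrix (RichFrame.riemannCoeff R ρ) w).rank = 1) :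
    ∃ i₀ : Fin 3,
      -- the coefficient `Z_{ij}^k` with distinct indices is nonzero exactly for `k = i₀`
      (∀ i j k, i ≠ j → j ≠ k → i ≠ k → ∀ w ∈ ρ.target,
        (RichFrame.riemannCoeff R ρ i j k w ≠ 0 ↔ k = i₀)) ∧
      -- every solution, and every extension, is degenerate
      (∀ V ⊆ ρ.target, IsOpen V → ∀ γ,
        RichFrame.IsBetaSolution (RichFrame.riemannCoeff R ρ) r V γ → ∀ w ∈ V, γ i₀ w = 0) ∧
      (∀ U ⊆ ρ.source, IsOpen U → ∀ η : (Fin 3 → ℝ) → ℝ, ContDiffOn ℝ 3 η U →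
        RichFrame.IsOrthogonalForHessian R η U →
          ∀ u ∈ U, fderiv ℝ (fderiv ℝ η) u (R i₀ u) (R i₀ u) = 0) ∧
      -- the regular points form an open and dense subset
      IsOpen {p ∈ ρ.target | RichFrame.IsRegularPoint (RichFrame.riemannCoeff R ρ) i₀ p} ∧
      ρ.target ⊆
        closure {p ∈ ρ.target | RichFrame.IsRegularPoint (RichFrame.riemannCoeff R ρ) i₀ p} ∧
      -- near every regular point exactly one of the three cases holds
      ∀ p ∈ ρ.target, RichFrame.IsRegularPoint (RichFrame.riemannCoeff R ρ) i₀ p →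
        (RichFrame.OnlyTrivial (RichFrame.riemannCoeff R ρ) r ρ.target p ∧
          ¬ RichFrame.OneFreeFunction (RichFrame.riemannCoeff R ρ) r ρ.target i₀ p ∧
          ¬ RichFrame.TwoFreeFunctions (RichFrame.riemannCoeff R ρ) r ρ.target i₀ p) ∨
        (¬ RichFrame.OnlyTrivial (RichFrame.riemannCoeff R ρ) r ρ.target p ∧
          RichFrame.OneFreeFunction (RichFrame.riemannCoeff R ρ) r ρ.target i₀ p ∧
          ¬ RichFrame.TwoFreeFunctions (RichFrame.riemannCoeff R ρ) r ρ.target i₀ p) ∨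
        (¬ RichFrame.OnlyTrivial (RichFrame.riemannCoeff R ρ) r ρ.target p ∧
          ¬ RichFrame.OneFreeFunction (RichFrame.riemannCoeff R ρ) r ρ.target i₀ p ∧
          RichFrame.TwoFreeFunctions (RichFrame.riemannCoeff R ρ) r ρ.target i₀ p) := by
  have hm2 : 1 + 1 ≤ m := le_trans (by gcongr) hrm
  have hm : 1 ≤ m := le_add_self.trans hm2
  obtain ⟨i₀, hi₀⟩ := hρ.exists_distinguishedIndex hm hconn hrank
  have hZ : RichFrame.IsRankOneConnection (RichFrame.riemannCoeff R ρ) r ρ.target i₀ :=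
    ⟨ρ.open_target, hρ.contDiffOn_riemannCoeff hrm,
      fun i j k w hw => hρ.riemannCoeff_symm hm hw i j k,
      fun l i j q w hw => hρ.flatness hm2 hw l i j q, hi₀⟩
  refine ⟨i₀, hi₀, fun V hV _ γ hγ => hγ.eq_zero hV hi₀,
    fun U hU hUo η hη horth => hρ.hessian_eq_zero hm hi₀ hU hUo hη horth,
    ρ.open_target.inter (RichFrame.isOpen_setOf_isRegularPoint _ i₀),
    (RichFrame.dense_setOf_isRegularPoint _ i₀).open_subset_closure_inter ρ.open_target,
    fun p hp hreg => ?_⟩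
  have hcard : (Finset.univ.erase i₀).card = 2 := by simp
  rcases hZ.exists_solutionsFreeIn hr hp hreg with h | ⟨l, hl, h⟩ | h
  · refine Or.inl ⟨h, ?_, fun h' => ?_⟩
    · rintro ⟨k, -, h'⟩
      simpa using congrArg Finset.card (h.eq h')
    · rw [← h.eq h'] at hcard
      simp at hcard
  · refine Or.inr (Or.inl ⟨fun h' => ?_, ⟨l, hl, h⟩, fun h' => ?_⟩)
    · simpa using congrArg Finset.card (h.eq h')
    · rw [← h.eq h'] at hcard
      simp at hcard
  · refine Or.inr (Or.inr ⟨fun h' => ?_, ?_, h⟩)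
    · rw [h.eq h'] at hcard
      simp at hcard
    · rintro ⟨k, -, h'⟩
      rw [h.eq h'] at hcard
      simp at hcard
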